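/- Let $\mathcal S$ be a finite set, $n\ge 1$, $T\ge 1$, and let $0\notin\mathcal S$ be an auxiliary symbol. For an ordered pair of markets $I=(I_1,I_2)\in\{1,\dots,n\}^2$ ($I_1=I_2$ allowed) and $S=(S_{i,t})\in\mathcal S^{nT}$, let $R_S(I,S)$ be the set of all $\tilde S\in\mathcal S^{nT}$ such that (a) $\tilde S_{i,1}=S_{i,1}$ for all $i$; (b) for all $i\notin\{I_1,I_2\}$ and $s,s'\in\mathcal S$, the number of $t\in\{1,\dots,T-1\}$ with $(\tilde S_{i,t},\tilde S_{i,t+1})=(s,s')$ equals the number of $t$ with $(S_{i,t},S_{i,t+1})=(s,s')$; (c) for all $s,s'$, the sums of these numbers over $i\in\{I_1,I_2\}$ (one term if $I_1=I_2$) agree for $\tilde S$ and $S$. **Euler algorithm** given a sequence $\xi=(\xi_1,\dots,\xi_V)$ in $\mathcal S\cup\{0\}$. Put $N(s,s')=\#\{1\le v\le V-1:(\xi_v,\xi_{v+1})=(s,s')\}$ and $N^{(0)}(s,s')=N(s,s')+1\{(\xi_V,\xi_1)=(s,s')\}$. (i) Start with $\zeta_1=\xi_V$ and, for $v=1,2,\dots$,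 draw $\zeta_{v+1}=s$ with probability $N^{(0)}(s,\zeta_v)/\sum_{s''}N^{(0)}(s'',\zeta_v)$, stopping as soon as $\{\zeta_1,\dots,\zeta_{v+1}\}$ contains every value occurring in $\xi$. (ii) For each visited $s\ne\xi_V$ let $e(s)$ be the value of $\zeta$ immediately before its first visit to $s$, and put $N^{(1)}(s,s')=N(s,s')-1\{s'=e(s)\}$; for all other $s$ nothing is subtracted. (iii) Put $\tilde\xi_1=\xi_1$. For $v=2,\dots,V$, with $s=\tilde\xi_{v-1}$, draw $\tilde\xi_v=s'$ with probability $N^{(v-1)}(s,s')/\sum_{s''}N^{(v-1)}(s,s'')$ if the denominator is at least $1$, and set $\tilde\xi_v=e(s)$ otherwise; then $N^{(v)}$ is $N^{(v-1)}$ with its entry at $(\tilde\xi_{v-1},\tilde\xi_v)$ lowered by one. The outcome is $\tilde\xi$. **Modified Euler algorithm** given $(I,S)$. If $I_1=I_2$, row $i$ of the outcome is drawn by the Euler algorithm given $(S_{i,1},\dots,S_{i,T})$, independently over $i=1,\dots,n$. If $I_1\ne I_2$, run the Euler algorithm given $(S_{I_1,1},\dots,S_{I_1,T},0,S_{I_2,1},\dots,S_{I_2,T},0)$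 repeatedly and independently until its outcome $\xi$ has $\xi_{T+1}=0$; row $I_1$ of the outcome is $(\xi_1,\dots,\xi_T)$, row $I_2$ is $(\xi_{T+2},\dots,\xi_{2T+1})$, and every other row $i$ is drawn independently by the Euler algorithm given $(S_{i,1},\dots,S_{i,T})$. **Lemma.** For all $I$ and $S$, the set $R_S(I,S)$ is non-empty, and the modified Euler algorithm given $(I,S)$ halts almost surely with an outcome uniformly distributed on $R_S(I,S)$. Consequently it implements the state-drawing step of the MCMC algorithm: if $X^{(j)}=(S^{(j)},A^{(j)})\in\mathcal S^{nT}\times\mathcal A^{nT}$, $k\ge2$, and $S^{(k)}$ is generated, given $(X^{(1)},\dots,X^{(k-1)},I^{(k)})$, by the modified Euler algorithm given $(I^{(k)},S^{(k-1)})$, then for every $\tilde S\in\mathcal S^{nT}$ $$P\big(S^{(k)}=\tilde S\mid X^{(1)},\dots,X^{(k-1)},I^{(k)}\big)=\frac{1\{\tilde S\in R_S(I^{(k)},S^{(k-1)})\}}{|R_S(I^{(k)},S^{(k-1)})|}.$$ -/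

import Mathlib

open scoped ENNReal

/-! ## Outcome laws of randomized algorithms

`Law α` is the law of the result of a randomized algorithm with results in a countable type `α`:
`μ a` is the probability that the algorithm halts with result `a`. The mass that is missing from
`1` is the probability of running forever or of meeting an undefined instruction. -/

universe u v

/-- The law of the result of a randomized algorithm. -/
def Law (α : Type u) : Type u := α → ℝ≥0∞

namespace Law

/-- Return `a`. -/
noncomputable def pure {α : Type u} (a : α) : Law α := by
  classical exact fun b => if b = a then 1 else 0

/-- An undefined instruction: no result. -/
noncomputable def fail {α : Type u} : Law α := fun _ => 0

/-- Run `μ`, then run `f` on its result with fresh randomness. -/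
noncomputable def bind {α : Type u} {β : Type v} (μ : Law α) (f : α → Law β) : Law β :=
  fun b => ∑' a, μ a * f a b

/-- Run the algorithms `μ i` independently of each other. -/
noncomputable def pi {ι : Type u} [Fintype ι] {α : Type v} (μ : ι → Law α) : Law (ι → α) :=
  fun x => ∏ i, μ i (x i)

/-- Draw `a` with probability proportional to `w a` (undefined if all weights vanish). -/
noncomputable def draw {α : Type u} [Fintype α] (w : α → ℕ) : Law α :=
  fun a => (w a : ℝ≥0∞) / ((∑ b, w b : ℕ) : ℝ≥0∞)

/-- The results that `loop` below reaches within at most `m` rounds. -/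
noncomputable def loopWithin {σ : Type u} {β : Type v} (body : σ → Law (σ ⊕ β)) :
    ℕ → σ → Law β
  | 0, _ => fail
  | m + 1, x => bind (body x) fun r =>
      match r with
      | Sum.inl y => loopWithin body m y
      | Sum.inr b => pure b

/-- Repeat `body`: a result `inl y` means "go round again from the state `y`", and a result `inr b`
means "leave the loop with the result `b`". -/
noncomputable def loop {σ : Type u} {β : Type v} (body : σ → Law (σ ⊕ β)) (x : σ) : Law β :=
  fun b => ⨆ m, loopWithin body m x b

end Law

/-! ## The Euler algorithm -/

section Euler

variable {α : Type u} [Fintype α] [DecidableEq α]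

/-- The number of positions `v = 1, …, V - 1` with `(ξ_v, ξ_{v+1}) = (s, s')`, where `V` is the
length of `ξ`. -/
def pairCount (ξ : List α) (s s' : α) : ℕ := (ξ.zip ξ.tail).count (s, s')

/-- `N⁽⁰⁾`: the transition counts of `ξ`, together with the closing transition `(ξ_V, ξ_1)`. -/
def closedPairCount (ξ : List α) (s s' : α) : ℕ :=
  (if ξ.getLast? = some s ∧ ξ.head? = some s' then 1 else 0) + pairCount ξ s s'

/-- One round of the backward walk `ζ`: given `ζ_1, …, ζ_v`, draw `ζ_{v+1} = s` with probability
`N⁽⁰⁾(s, ζ_v) / ∑ s'', N⁽⁰⁾(s'', ζ_v)`, and leave as soon as every value that occurs in `ξ` has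
been visited. -/
noncomputable def backwardRound (ξ : List α) (ζ : List α) : Law (List α ⊕ List α) :=
  match ζ.getLast? with
  | none => Law.fail
  | some s' => Law.bind (Law.draw fun s => closedPairCount ξ s s') fun s =>
      if ∀ a ∈ ξ, a ∈ ζ ++ [s] then Law.pure (Sum.inr (ζ ++ [s]))
      else Law.pure (Sum.inl (ζ ++ [s]))

/-- The backward walk, started at `ζ_1 = ξ_V`. -/
noncomputable def backwardWalk (ξ : List α) : Law (List α) :=
  match ξ.getLast? with
  | none => Law.fail
  | some a => Law.loop (backwardRound ξ) [a]

/-- `ζ_{min {v : ζ_v = s} - 1}`, the value that `ζ` takes just before its first visit to `s`. There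
is none if `s = ζ_1` or if `s` is not visited. -/
def lastExit (ζ : List α) (s : α) : Option α :=
  if s ∈ ζ then
    match ζ.idxOf s with
    | 0 => none
    | j + 1 => ζ[j]?
  else none

/-- `N⁽¹⁾`: the transition counts of `ξ`, with the last exit from each value set aside. -/
def reservedPairCount (ξ ζ : List α) (s s' : α) : ℕ :=
  pairCount ξ s s' - if lastExit ζ s = some s' then 1 else 0

/-- The next value after `s`, when `N` holds the transitions still available: drawn with
probabilities proportional to `N(s, ·)`, and the last exit from `s` if none is left. -/
noncomputable def forwardStep (ζ : List α) (N : α → α → ℕ) (s : α) : Law α :=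
  if 1 ≤ ∑ s', N s s' then Law.draw (N s)
  else
    match lastExit ζ s with
    | none => Law.fail
    | some s' => Law.pure s'

/-- The next `m` values after `s`; each transition that is made is removed from `N`. -/
noncomputable def forwardWalk (ζ : List α) : ℕ → (α → α → ℕ) → α → Law (List α)
  | 0, _, _ => Law.pure []
  | m + 1, N, s => Law.bind (forwardStep ζ N s) fun s' =>
      Law.bind
        (forwardWalk ζ m (fun a b => N a b - if (s, s') = (a, b) then 1 else 0) s')
        fun l => Law.pure (s' :: l)

/-- The law of the outcome of the Euler algorithm given the sequence `ξ`. -/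
noncomputable def eulerAlgorithm (ξ : List α) : Law (List α) :=
  Law.bind (backwardWalk ξ) fun ζ =>
    match ξ with
    | [] => Law.fail
    | a :: _ => Law.bind (forwardWalk ζ (ξ.length - 1) (reservedPairCount ξ ζ) a) fun l =>
        Law.pure (a :: l)

end Euler

/-! ## The draw of the new state configuration -/

/-- A state configuration for `n` markets and `T` periods; also used for actions. -/
abbrev Config (n T : ℕ) (𝒮 : Type u) : Type u := Fin n → Fin T → 𝒮

section States

variable {𝒮 : Type u} [Fintype 𝒮] [DecidableEq 𝒮] {n T : ℕ}

/-- The number of periods `t = 1, …, T - 1` with `(x_t, x_{t+1}) = (s, s')`. -/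
def transitionCount (x : Fin T → 𝒮) (s s' : 𝒮) : ℕ :=
  (Finset.univ.filter fun t : Fin T =>
    ∃ h : (t : ℕ) + 1 < T, x t = s ∧ x ⟨(t : ℕ) + 1, h⟩ = s').card

open Classical in
/-- `R_S(I, S)` for the pair of markets `I = (I_1, I_2)`. -/
noncomputable def RS (I : Fin n × Fin n) (S : Config n T 𝒮) : Finset (Config n T 𝒮) :=
  Finset.univ.filter fun S' =>
    (∀ i, ∀ t : Fin T, (t : ℕ) = 0 → S' i t = S i t) ∧
    (∀ s s', ∀ i ∉ ({I.1, I.2} : Finset (Fin n)),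
      transitionCount (S' i) s s' = transitionCount (S i) s s') ∧
    (∀ s s', ∑ i ∈ ({I.1, I.2} : Finset (Fin n)), transitionCount (S' i) s s' =
      ∑ i ∈ ({I.1, I.2} : Finset (Fin n)), transitionCount (S i) s s')

/-- A market's states as a sequence in `𝒮 ∪ {0}`; this set is `Option 𝒮`, with `none` as `0`. -/
def toSeq (x : Fin T → 𝒮) : List (Option 𝒮) := List.ofFn fun t => some (x t)

/-- `(S_{I_1,1}, …, S_{I_1,T}, 0, S_{I_2,1}, …, S_{I_2,T}, 0)`. -/
def joinedSeq (I : Fin n × Fin n) (S : Config n T 𝒮) : List (Option 𝒮) :=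
  toSeq (S I.1) ++ [none] ++ toSeq (S I.2) ++ [none]

/-- Run the Euler algorithm on the joined sequence again and again, independently, until entry
`T + 1` of the outcome is `0`. -/
noncomputable def joinedDraw (I : Fin n × Fin n) (S : Config n T 𝒮) : Law (List (Option 𝒮)) :=
  Law.loop
    (fun _ : Unit => Law.bind (eulerAlgorithm (joinedSeq I S)) fun ξ =>
      if ξ[T]? = some none then Law.pure (Sum.inr ξ) else Law.pure (Sum.inl ()))
    ()

/-- The modified Euler algorithm, for the pair `I` and the current states `S`: the law of the `n`
new sequences, as sequences in `𝒮 ∪ {0}`. -/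
noncomputable def modifiedEulerSeqs (I : Fin n × Fin n) (S : Config n T 𝒮) :
    Law (Fin n → List (Option 𝒮)) :=
  if I.1 ≠ I.2 then
    Law.bind (joinedDraw I S) fun ξ =>
      Law.pi fun i =>
        if i = I.1 then Law.pure (ξ.take T)
        else if i = I.2 then Law.pure ((ξ.drop (T + 1)).take T)
        else eulerAlgorithm (toSeq (S i))
  else Law.pi fun i => eulerAlgorithm (toSeq (S i))

/-- The modified Euler algorithm: the probability that it halts with the new state configuration
`S'`. A run whose sequences do not form an element of `𝒮^{nT}` counts as one without result. -/
noncomputable def modifiedEuler (I : Fin n × Fin n) (S : Config n T 𝒮) : Law (Config n T 𝒮) :=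
  fun S' => modifiedEulerSeqs I S fun i => toSeq (S' i)

/-- The event `X^(1) = x_1, …, X^(k-1) = x_{k-1}, I^(k) = I`. -/
def historyEvent {Ω : Type*} {𝒳 : Type*} (X : ℕ → Ω → 𝒳) (J : ℕ → Ω → Fin n × Fin n) (k : ℕ)
    (x : ℕ → 𝒳) (I : Fin n × Fin n) : Set Ω :=
  {ω | (∀ j, 1 ≤ j → j ≤ k - 1 → X j ω = x j) ∧ J k ω = I}

/-- `S^(k)`, the state part of `X^(k) = (S^(k), A^(k))`, is generated by the modified Euler
algorithm, given `(X^(1), …, X^(k-1), I^(k))`. -/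
def GeneratedByModifiedEuler {Ω : Type*} [MeasurableSpace Ω] (P : MeasureTheory.Measure Ω)
    {𝒜 : Type*} (X : ℕ → Ω → Config n T 𝒮 × Config n T 𝒜) (J : ℕ → Ω → Fin n × Fin n)
    (k : ℕ) : Prop :=
  ∀ x I, P (historyEvent X J k x I) ≠ 0 → ∀ S' : Config n T 𝒮,
    ProbabilityTheory.cond P (historyEvent X J k x I) {ω | (X k ω).1 = S'} =
      modifiedEuler I (x (k - 1)).1 S'

end States

-- The Euler algorithm is the constructive side of the BEST theorem. A sequence with prescribed
-- first value and transition counts ends at a prescribed value `r`. It is determined by two pieces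
-- of data: the map sending each value other than `r` to its successor after its last occurrence,
-- which is a spanning tree directed towards `r`, and, for each value, the order in which its other
-- exits are used. Conversely, every such tree together with any orders of the other exits gives an
-- admissible sequence, because a walk that saves its tree exits for last cannot get stuck
-- (`IsForwardState.mem_of_row_eq_zero`).
--
-- The backward walk is the Aldous–Broder algorithm: read backwards, first entrances are last exits,
-- and the tree `t` appears with probability proportional to the product of the counts `N(v, t v)`
-- (`tsum_backwardWalk_lastExit`). The proof exhibits a harmonic function of the walk, `exitCount`,
-- which starts as the weight of `t` and, once everything is covered, is a constant times the
-- indicator that the tree found is `t`. Harmonicity is a count of maps with a single cycle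
-- (`sum_treeWeight_step`); the constant does not depend on the end point because the closed
-- transition graph is balanced and connected (`sum_treeWeight_root`).
--
-- Given the tree, the forward walk produces each order of the other exits with the same probability
-- `orderProb` (`forwardWalk_law`). The product of tree weight and `orderProb` is free of the tree
-- (`treeWeight_mul_orderProb`), so the outcome is uniform (`exists_eulerAlgorithm_eq`).
--
-- For two distinct markets, the accepted outcomes are exactly the joined rows with the right first
-- values and total counts (`joinRows_equivalent_iff`, `exists_joinRows_eq`), and conditioning a
-- uniform law leaves it uniform. No normalising constant is computed: the law is constant on `RS I
-- S`, vanishes elsewhere and has mass one.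

attribute [reducible] Law

/-! ### Laws of randomized algorithms and of their loops. -/

theorem ENNReal.tsum_iSup_of_monotone {ι : Type*} (f : ℕ → ι → ℝ≥0∞) (hf : Monotone f) :
    ∑' a, ⨆ m, f m a = ⨆ m, ∑' a, f m a := by
  apply le_antisymm
  · rw [ENNReal.tsum_eq_iSup_sum]
    refine iSup_le fun F => ?_
    rw [ENNReal.finsetSum_iSup_of_monotone (fun a m n h => hf h a)]
    exact iSup_mono fun m => ENNReal.sum_le_tsum F
  · exact iSup_le fun m => ENNReal.tsum_le_tsum fun a => le_iSup (fun m => f m a) m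

namespace Law

variable {σ : Type u} {α : Type u} {β : Type v}

theorem pure_apply [DecidableEq α] (a b : α) : (pure a : Law α) b = if b = a then 1 else 0 := by
  unfold pure; congr

theorem tsum_bind_mul (μ : Law α) (f : α → Law β) (h : β → ℝ≥0∞) :
    ∑' b, bind μ f b * h b = ∑' a, μ a * ∑' b, f a b * h b := by
  simp only [bind, ← ENNReal.tsum_mul_right, ← ENNReal.tsum_mul_left]
  rw [ENNReal.tsum_comm]
  simp only [mul_assoc]

theorem tsum_bind (μ : Law α) (f : α → Law β) :
    ∑' b, bind μ f b = ∑' a, μ a * ∑' b, f a b := by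
  simpa using tsum_bind_mul μ f 1

theorem tsum_pure_mul (a : α) (h : α → ℝ≥0∞) : ∑' b, (pure a : Law α) b * h b = h a := by
  classical
  rw [tsum_eq_single a]
  · simp [pure_apply]
  · intro b hb
    simp [pure_apply, hb]

theorem tsum_pure (a : α) : ∑' b, (pure a : Law α) b = 1 := by
  simpa using tsum_pure_mul a 1

theorem bind_pure_inj {γ : Type v} (μ : Law α) {f : α → γ} (hf : Function.Injective f) (a : α) :
    bind μ (fun a => pure (f a)) (f a) = μ a := by
  classical
  unfold bind
  rw [tsum_eq_single a]
  · simp [pure_apply]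
  · intro b hb
    simp [pure_apply, (hf.ne hb).symm]

theorem bind_pure_notMem {γ : Type v} (μ : Law α) {f : α → γ} {c : γ} (hc : ∀ a, f a ≠ c) :
    bind μ (fun a => pure (f a)) c = 0 := by
  classical
  unfold bind
  simp [pure_apply, fun a => (hc a).symm]

theorem tsum_draw [Fintype α] {w : α → ℕ} (hw : 0 < ∑ a, w a) : ∑' a, draw w a = 1 := by
  rw [tsum_fintype]
  unfold draw
  simp only [div_eq_mul_inv]
  rw [← Finset.sum_mul, ← Nat.cast_sum]
  exact ENNReal.mul_inv_cancel (by exact_mod_cast hw.ne') (ENNReal.natCast_ne_top _)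

section Loop

variable (body : σ → Law (σ ⊕ β))

/-- The results of the rounds, with a value for each continuation. -/
theorem loopWithin_succ (m : ℕ) (x : σ) (b : β) :
    loopWithin body (m + 1) x b =
      ∑' r, body x r * Sum.elim (fun y => loopWithin body m y b)
        (fun b' => (pure b' : Law β) b) r := by
  simp only [loopWithin, bind]
  congr 1; funext r
  cases r <;> rfl

theorem loopWithin_le_succ (m : ℕ) (x : σ) (b : β) :
    loopWithin body m x b ≤ loopWithin body (m + 1) x b := by
  induction m generalizing x with
  | zero => simp [loopWithin, fail]
  | succ m ih =>
    rw [loopWithin_succ, loopWithin_succ body (m + 1)]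
    refine ENNReal.tsum_le_tsum fun r => mul_le_mul_right ?_ _
    cases r with
    | inl y => exact ih y
    | inr b' => exact le_rfl

theorem monotone_loopWithin (x : σ) (b : β) : Monotone fun m => loopWithin body m x b :=
  monotone_nat_of_le_succ fun m => loopWithin_le_succ body m x b

theorem tsum_loopWithin_succ_mul (m : ℕ) (x : σ) (h : β → ℝ≥0∞) :
    ∑' b, loopWithin body (m + 1) x b * h b =
      ∑' r, body x r * Sum.elim (fun y => ∑' b, loopWithin body m y b * h b) h r := by
  simp only [loopWithin]
  rw [tsum_bind_mul]
  congr 1; funext r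
  cases r with
  | inl y => rfl
  | inr b => exact congrArg _ (tsum_pure_mul b h)

theorem tsum_loop_mul (x : σ) (h : β → ℝ≥0∞) :
    ∑' b, loop body x b * h b = ⨆ m, ∑' b, loopWithin body m x b * h b := by
  unfold loop
  simp only [ENNReal.iSup_mul]
  exact ENNReal.tsum_iSup_of_monotone _ fun m n hmn b =>
    mul_le_mul_left (monotone_loopWithin body x b hmn) _

/-- First-step analysis: the identity for finitely many rounds passes to the limit by monotone
convergence. -/
theorem tsum_loop_mul_eq (x : σ) (h : β → ℝ≥0∞) :
    ∑' b, loop body x b * h b =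
      ∑' r, body x r * Sum.elim (fun y => ∑' b, loop body y b * h b) h r := by
  have hm : Monotone fun m => ∑' b, loopWithin body m x b * h b := fun m n hmn =>
    ENNReal.tsum_le_tsum fun b => mul_le_mul_left (monotone_loopWithin body x b hmn) _
  rw [tsum_loop_mul, ← hm.iSup_nat_add 1]
  simp only [tsum_loopWithin_succ_mul, tsum_loop_mul]
  rw [← ENNReal.tsum_iSup_of_monotone]
  · congr 1; funext r
    rw [← ENNReal.mul_iSup]
    cases r with
    | inl y => rfl
    | inr b => simp
  · intro m n hmn r
    refine mul_le_mul_right ?_ _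
    cases r with
    | inl y =>
      exact ENNReal.tsum_le_tsum fun b => mul_le_mul_left (monotone_loopWithin body y b hmn) _
    | inr b => exact le_rfl

variable {body} {Inv : σ → Prop}

/-- A superharmonic `G` bounds the expected final reward, since runs unfinished after `m` rounds
contribute zero, which is at most `G`. Even for harmonic `G` only an inequality results; equality
needs a separate argument about the total mass. -/
theorem tsum_loop_mul_le (hInv : ∀ x y, Inv x → body x (Sum.inl y) ≠ 0 → Inv y)
    {G : σ → ℝ≥0∞} {h : β → ℝ≥0∞}
    (hG : ∀ x, Inv x → ∑' r, body x r * Sum.elim G h r ≤ G x) {x : σ} (hx : Inv x) :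
    ∑' b, loop body x b * h b ≤ G x := by
  rw [tsum_loop_mul]
  refine iSup_le fun m => ?_
  induction m generalizing x with
  | zero => simp [loopWithin, fail]
  | succ m ih =>
    rw [tsum_loopWithin_succ_mul]
    refine le_trans (ENNReal.tsum_le_tsum fun r => ?_) (hG x hx)
    cases r with
    | inl y =>
      by_cases h0 : body x (Sum.inl y) = 0
      · simp [h0]
      · exact mul_le_mul_right (ih (hInv x y hx h0)) _
    | inr b => exact le_rfl

theorem loop_support (hInv : ∀ x y, Inv x → body x (Sum.inl y) ≠ 0 → Inv y)
    {Post : β → Prop} (hPost : ∀ x b, Inv x → body x (Sum.inr b) ≠ 0 → Post b)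
    {x : σ} (hx : Inv x) {b : β} (hb : loop body x b ≠ 0) : Post b := by
  classical
  -- With the indicator of a violation as reward, the zero function is superharmonic.
  have := tsum_loop_mul_le hInv (G := fun _ => 0) (h := fun b => if Post b then 0 else 1)
    (fun x hx => by
      refine le_of_eq (ENNReal.tsum_eq_zero.2 fun r => ?_)
      cases r with
      | inl y => simp
      | inr b =>
        by_cases h0 : body x (Sum.inr b) = 0
        · simp [h0]
        · simp [hPost x b hx h0]) hx
  have h2 := ENNReal.tsum_eq_zero.1 (le_antisymm this zero_le) b
  by_contra hP
  simp [hP, hb] at h2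

/-- A loop halts almost surely if from each state it halts within `K` rounds with a probability
that is bounded below. -/
theorem tsum_loop_eq_one (hInv : ∀ x y, Inv x → body x (Sum.inl y) ≠ 0 → Inv y)
    (hbody : ∀ x, Inv x → ∑' r, body x r = 1) (K : ℕ) {ε : ℝ≥0∞} (hε : ε ≠ 0)
    (hK : ∀ x, Inv x → ε ≤ ∑' b, loopWithin body K x b) {x : σ} (hx : Inv x) :
    ∑' b, loop body x b = 1 := by
  set p : σ → ℝ≥0∞ := fun x => ∑' b, loop body x b with hp
  have hp1 : ∀ x, Inv x → p x ≤ 1 := fun x hx => by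
    have := tsum_loop_mul_le hInv (G := 1) (h := 1) (fun x hx => by
      refine le_of_eq ?_
      rw [Pi.one_apply, ← hbody x hx]
      refine tsum_congr fun r => ?_
      cases r <;> simp) hx
    simpa [hp] using this
  set i : ℝ≥0∞ := ⨅ y : {y // Inv y}, p y with hi
  have hi_le : ∀ y, Inv y → i ≤ p y := fun y hy => iInf_le (fun y : {y // Inv y} => p y) ⟨y, hy⟩
  have hi1 : i ≤ 1 := (hi_le x hx).trans (hp1 x hx)
  -- A run that has not halted within `m` rounds still halts with probability at least the infimum
  -- `i`. For `m = K` this gives `ε * (1 - i) + i ≤ i`, hence `i = 1`.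
  have key : ∀ m x, Inv x → (∑' b, loopWithin body m x b) * (1 - i) + i ≤ p x := by
    intro m
    induction m with
    | zero => intro x hx; simpa [loopWithin, fail] using hi_le x hx
    | succ m ih =>
      intro x hx
      have e1 := tsum_loopWithin_succ_mul body m x 1
      have e2 := tsum_loop_mul_eq body x 1
      simp only [Pi.one_apply, mul_one] at e1 e2
      rw [hp]
      simp only
      rw [e1, e2]
      calc _ = ∑' r, body x r * (Sum.elim (fun y => ∑' b, loopWithin body m y b) 1 r * (1 - i) + i)
            := by
            simp only [mul_add, ENNReal.tsum_add, ← mul_assoc]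
            rw [ENNReal.tsum_mul_right, ENNReal.tsum_mul_right, hbody x hx, one_mul]
        _ ≤ _ := by
            refine ENNReal.tsum_le_tsum fun r => ?_
            cases r with
            | inl y =>
              by_cases h0 : body x (Sum.inl y) = 0
              · simp [h0]
              · exact mul_le_mul_right (ih y (hInv x y hx h0)) _
            | inr b => exact mul_le_mul_right (by simp [tsub_add_cancel_of_le hi1]) _
  have h2 : ε * (1 - i) + i ≤ i := by
    have : Nonempty {y // Inv y} := ⟨⟨x, hx⟩⟩
    refine le_iInf fun y => le_trans ?_ (key K y y.2)
    gcongr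
    exact hK y y.2
  have hit : i ≠ ∞ := ne_top_of_le_ne_top ENNReal.one_ne_top hi1
  have h3 : ε * (1 - i) = 0 := by
    have : ε * (1 - i) + i ≤ 0 + i := by simpa using h2
    exact le_antisymm ((ENNReal.add_le_add_iff_right hit).1 this) zero_le
  have h4 : 1 - i = 0 := (mul_eq_zero.1 h3).resolve_left hε
  exact le_antisymm (hp1 x hx) ((tsub_eq_zero_iff_le.1 h4).trans (hi_le x hx))

end Loop

end Law

/-! ### Transition counts of sequences and the map of last exits. -/

section Lists

variable {α : Type u} [DecidableEq α]

theorem pairCount_nil (a b : α) : pairCount ([] : List α) a b = 0 := by simp [pairCount]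

theorem pairCount_singleton (x a b : α) : pairCount [x] a b = 0 := by simp [pairCount]

theorem pairCount_cons_cons (x y : α) (l : List α) (a b : α) :
    pairCount (x :: y :: l) a b = (if x = a ∧ y = b then 1 else 0) + pairCount (y :: l) a b := by
  simp [pairCount, List.count_cons, add_comm]

theorem pairCount_append (p q : List α) (a b : α) :
    pairCount (p ++ q) a b = pairCount p a b + pairCount q a b +
      if p.getLast? = some a ∧ q.head? = some b then 1 else 0 := by
  induction p with
  | nil => simp [pairCount_nil]
  | cons x p ih =>
    cases p with
    | nil =>
      cases q with
      | nil => simp [pairCount_nil, pairCount_singleton]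
      | cons y q => simp [pairCount_cons_cons, pairCount_singleton, add_comm]
    | cons y p =>
      simp only [List.cons_append, pairCount_cons_cons, List.getLast?_cons_cons] at ih ⊢
      omega

theorem pairCount_concat (p : List α) (s a b : α) :
    pairCount (p ++ [s]) a b =
      pairCount p a b + if p.getLast? = some a ∧ s = b then 1 else 0 := by
  simp [pairCount_append, pairCount_singleton]

theorem pairCount_reverse (p : List α) (a b : α) :
    pairCount p.reverse a b = pairCount p b a := by
  induction p with
  | nil => simp [pairCount_nil]
  | cons x p ih =>
    rw [List.reverse_cons, pairCount_concat, ih]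
    cases p with
    | nil => simp [pairCount_nil, pairCount_singleton]
    | cons y p =>
      simp only [pairCount_cons_cons, List.getLast?_reverse, List.head?_cons, Option.some_inj,
        and_comm]
      omega

section Balance

variable [Fintype α]

/-- Every occurrence of `a` starts a transition, except one at the end of the sequence. -/
theorem sum_pairCount_right (ξ : List α) (a : α) :
    ∑ b, pairCount ξ a b + (if ξ.getLast? = some a then 1 else 0) = ξ.count a := by
  induction ξ with
  | nil => simp [pairCount_nil]
  | cons x ξ ih =>
    cases ξ with
    | nil => simp [pairCount_singleton, List.count_cons]
    | cons y ξ =>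
      rw [List.count_cons, ← ih]
      simp only [pairCount_cons_cons, Finset.sum_add_distrib, List.getLast?_cons_cons]
      by_cases h : x = a
      · simp only [h, true_and, Finset.sum_ite_eq, Finset.mem_univ, if_true, beq_self_eq_true]
        omega
      · simp [h]

theorem sum_pairCount_left (ξ : List α) (b : α) :
    ∑ a, pairCount ξ a b + (if ξ.head? = some b then 1 else 0) = ξ.count b := by
  have := sum_pairCount_right ξ.reverse b
  simpa [pairCount_reverse] using this

theorem sum_pairCount (ξ : List α) : ∑ a, ∑ b, pairCount ξ a b = ξ.length - 1 := by
  induction ξ with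
  | nil => simp [pairCount_nil]
  | cons x ξ ih =>
    cases ξ with
    | nil => simp [pairCount_singleton]
    | cons y ξ =>
      simp only [pairCount_cons_cons, Finset.sum_add_distrib, ih, ite_and]
      simp [add_comm]

theorem pairCount_le_count_left (ξ : List α) (a b : α) : pairCount ξ a b ≤ ξ.count a := by
  rw [← sum_pairCount_right]
  exact (Finset.single_le_sum (f := fun b => pairCount ξ a b) (fun _ _ => zero_le)
    (Finset.mem_univ b)).trans (Nat.le_add_right _ _)

theorem pairCount_le_count_right (ξ : List α) (a b : α) : pairCount ξ a b ≤ ξ.count b := by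
  rw [← sum_pairCount_left]
  exact (Finset.single_le_sum (f := fun a => pairCount ξ a b) (fun _ _ => zero_le)
    (Finset.mem_univ a)).trans (Nat.le_add_right _ _)

theorem perm_of_pairCount_eq {ξ ξ' : List α} (h : pairCount ξ' = pairCount ξ)
    (hh : ξ'.head? = ξ.head?) : ξ'.Perm ξ := by
  rw [List.perm_iff_count]
  intro a
  rw [← sum_pairCount_left, ← sum_pairCount_left, h, hh]

/-- The end is the one value that occurs once more than it is left, and occurrences are fixed by the
first value and the counts. -/
theorem getLast?_eq_of_pairCount_eq {ξ ξ' : List α} (h : pairCount ξ' = pairCount ξ)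
    (hh : ξ'.head? = ξ.head?) : ξ'.getLast? = ξ.getLast? := by
  have hp := perm_of_pairCount_eq h hh
  ext a
  have h1 := sum_pairCount_right ξ' a
  have h2 := sum_pairCount_right ξ a
  rw [h, hp.count_eq a, ← h2] at h1
  simp only [Nat.add_left_cancel_iff] at h1
  split_ifs at h1 <;> simp_all

end Balance

theorem mem_left_of_pairCount_pos [Fintype α] {ξ : List α} {a b : α} (h : 0 < pairCount ξ a b) :
    a ∈ ξ := List.count_pos_iff.1 (h.trans_le (pairCount_le_count_left ξ a b))

theorem mem_right_of_pairCount_pos [Fintype α] {ξ : List α} {a b : α} (h : 0 < pairCount ξ a b) :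
    b ∈ ξ := List.count_pos_iff.1 (h.trans_le (pairCount_le_count_right ξ a b))

theorem lastExit_of_notMem {ζ : List α} {v : α} (h : v ∉ ζ) : lastExit ζ v = none := by
  simp [lastExit, h]

theorem lastExit_singleton (r v : α) : lastExit [r] v = none := by
  unfold lastExit
  split_ifs with h
  · obtain rfl : v = r := by simpa using h
    simp
  · rfl

/-- Prolonging the walk can only add an exit for a value met for the first time; this drives all
inductions on prefixes. -/
theorem lastExit_concat (q : List α) (s v : α) :
    lastExit (q ++ [s]) v =
      if v ∈ q then lastExit q v else if v = s then q.getLast? else none := by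
  by_cases hv : v ∈ q
  · simp only [lastExit, List.mem_append, hv, true_or, if_true, List.idxOf_append_of_mem hv]
    have := List.idxOf_lt_length_of_mem hv
    cases h : q.idxOf v with
    | zero => rfl
    | succ j => simp only; rw [List.getElem?_append_left (by omega)]
  · by_cases hs : v = s
    · subst hs
      simp only [lastExit, List.mem_append, hv, List.mem_singleton, or_true, if_true, if_false,
        List.idxOf_append_of_notMem hv]
      rcases List.eq_nil_or_concat q with rfl | ⟨q', z, rfl⟩
      · simp
      · simp
    · rw [lastExit_of_notMem (by simp [hv, hs])]
      simp [hv, hs]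

theorem lastExit_head {ζ : List α} {r : α} (h : ζ.head? = some r) : lastExit ζ r = none := by
  cases ζ with
  | nil => simp at h
  | cons x ζ =>
    obtain rfl : x = r := by simpa using h
    simp [lastExit]

theorem pairCount_pos_of_lastExit {ζ : List α} {v u : α} (h : lastExit ζ v = some u) :
    0 < pairCount ζ u v := by
  induction ζ using List.reverseRecOn with
  | nil => simp [lastExit] at h
  | append_singleton q s ih =>
    rw [lastExit_concat] at h
    rw [pairCount_concat]
    split_ifs at h with h1 h2
    · exact (ih h).trans_le (Nat.le_add_right _ _)
    · simp [h, h2]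

/-- The exit of a value was visited before the value itself, so following exits leads back to the
start of the walk. -/
theorem lastExit_reaches_head {ζ : List α} {r : α} (hr : ζ.head? = some r) {v : α} (hv : v ∈ ζ) :
    Relation.ReflTransGen (fun a b => lastExit ζ a = some b) v r := by
  induction ζ using List.reverseRecOn generalizing v with
  | nil => simp at hv
  | append_singleton q s ih =>
    rcases q.eq_nil_or_concat with rfl | ⟨q', z, hq⟩
    · simp only [List.nil_append, List.head?_cons, Option.some.injEq, List.mem_singleton] at hr hv
      rw [hv, hr]
    · have hne : q ≠ [] := by simp [hq]
      rw [List.head?_append_of_ne_nil _ hne] at hr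
      have key : ∀ v ∈ q, Relation.ReflTransGen (fun a b => lastExit (q ++ [s]) a = some b) v r := by
        intro v hv
        refine Relation.ReflTransGen.mono (fun a b hab => ?_) _ _ (ih hr hv)
        have ha : a ∈ q := by
          by_contra h
          simp [lastExit_of_notMem h] at hab
        rw [lastExit_concat, if_pos ha, hab]
      by_cases hvq : v ∈ q
      · exact key v hvq
      · obtain rfl : v = s := by simpa [hvq] using hv
        refine Relation.ReflTransGen.head (b := z) ?_ (key z (by simp [hq]))
        rw [lastExit_concat, if_neg hvq, if_pos rfl]
        simp [hq]

end Lists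

/-! ### Spanning trees, maps with a single cycle, and the Markov chain tree identity. -/

section Trees

variable {α : Type u}

/-- `t` is a spanning tree of `B`, directed towards its root `r`: `t v` is the exit from `v`. -/
structure IsExitTree (B : Finset α) (r : α) (t : α → Option α) : Prop where
  off : ∀ v, v ∉ B → t v = none
  root : t r = none
  reach : ∀ v ∈ B, Relation.ReflTransGen (fun a b => t a = some b) v r

/-- A map of `B` to itself under which all of `B` reaches `r`. -/
structure IsRecurrentMap (B : Finset α) (r : α) (g : α → Option α) : Prop where
  off : ∀ v, v ∉ B → g v = none
  on : ∀ v ∈ B, ∃ u ∈ B, g v = some u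
  reach : ∀ v ∈ B, Relation.ReflTransGen (fun a b => g a = some b) v r

/-- A path to `r` may be cut off when it first meets `r`, so the exit from `r` is irrelevant. This
lets a root exit be added or removed freely. -/
theorem reaches_of_eq_of_ne {t g : α → Option α} {r : α} (h : ∀ v, v ≠ r → t v = g v) {v : α}
    (hv : Relation.ReflTransGen (fun a b => t a = some b) v r) :
    Relation.ReflTransGen (fun a b => g a = some b) v r := by
  induction hv using Relation.ReflTransGen.head_induction_on with
  | refl => exact .refl
  | head h1 _ ih =>
    rename_i a c _
    by_cases ha : a = r
    · rw [ha]
    · exact .head (by rw [← h a ha]; exact h1) ih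

theorem IsExitTree.exists_exit {B : Finset α} {r : α} {t : α → Option α} (ht : IsExitTree B r t)
    (hr : r ∈ B) {v : α} (hv : v ∈ B) (hvr : v ≠ r) : ∃ u ∈ B, t v = some u := by
  rcases (ht.reach v hv).cases_head with h | ⟨u, hu, hur⟩
  · exact absurd h hvr
  · refine ⟨u, ?_, hu⟩
    rcases hur.cases_head with h | ⟨w, hw, -⟩
    · rwa [h]
    · by_contra hB
      simp [ht.off u hB] at hw

theorem IsRecurrentMap.succ {B : Finset α} {s s' : α} {g : α → Option α}
    (hg : IsRecurrentMap B s g) (h : g s = some s') : IsRecurrentMap B s' g :=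
  ⟨hg.off, hg.on, fun v hv => (hg.reach v hv).tail h⟩

variable [DecidableEq α]

theorem IsExitTree.update {B : Finset α} {s u : α} {t : α → Option α} (ht : IsExitTree B s t)
    (hs : s ∈ B) (hu : u ∈ B) : IsRecurrentMap B s (Function.update t s (some u)) where
  off v hv := by
    rw [Function.update_of_ne (by rintro rfl; exact hv hs), ht.off v hv]
  on v hv := by
    by_cases h : v = s
    · exact ⟨u, hu, by rw [h, Function.update_self]⟩
    · rw [Function.update_of_ne h]
      exact ht.exists_exit hs hv h
  reach v hv := reaches_of_eq_of_ne
    (fun v hv => (Function.update_of_ne hv _ _).symm) (ht.reach v hv)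

theorem IsRecurrentMap.update {B : Finset α} {s : α} {g : α → Option α}
    (hg : IsRecurrentMap B s g) : IsExitTree B s (Function.update g s none) where
  off v hv := by
    by_cases h : v = s
    · rw [h, Function.update_self]
    · rw [Function.update_of_ne h, hg.off v hv]
  root := Function.update_self ..
  reach v hv := reaches_of_eq_of_ne
    (fun v hv => (Function.update_of_ne hv _ _).symm) (hg.reach v hv)

/-- `s'` lies on the cycle of `g`: its image leads back to it, and the last value before the return
is its predecessor on the cycle. -/
theorem IsRecurrentMap.exists_pred {B : Finset α} {s' : α} {g : α → Option α} (hs' : s' ∈ B)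
    (hg : IsRecurrentMap B s' g) : ∃ s ∈ B, IsRecurrentMap B s g ∧ g s = some s' := by
  obtain ⟨u, huB, hu⟩ := hg.on s' hs'
  rcases (hg.reach u huB).cases_tail with h | ⟨s, hus, hs⟩
  · exact ⟨s', hs', hg, by rw [hu, h]⟩
  · refine ⟨s, ?_, ⟨hg.off, hg.on, fun v hv => ?_⟩, hs⟩
    · by_contra hB
      simp [hg.off s hB] at hs
    · exact ((hg.reach v hv).tail hu).trans hus

/-- On the finite set of recurrent values, `g` is onto by `exists_pred`, hence injective. -/
theorem IsRecurrentMap.pred_unique {B : Finset α} {s₁ s₂ s' : α} {g : α → Option α}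
    (h₁ : s₁ ∈ B) (h₂ : s₂ ∈ B) (hg₁ : IsRecurrentMap B s₁ g) (hg₂ : IsRecurrentMap B s₂ g)
    (hs₁ : g s₁ = some s') (hs₂ : g s₂ = some s') : s₁ = s₂ := by
  classical
  let R := B.filter fun s => IsRecurrentMap B s g
  let f : α → α := fun v => (g v).getD v
  have hmaps : Set.MapsTo f R R := by
    intro s hs
    obtain ⟨hsB, hs⟩ := Finset.mem_filter.1 hs
    obtain ⟨u, hu, hgu⟩ := hs.on s hsB
    simpa [R, f, hgu, hu] using hs.succ hgu
  have hsurj : Set.SurjOn f R R := by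
    intro s hs
    obtain ⟨hsB, hs⟩ := Finset.mem_filter.1 hs
    obtain ⟨u, hu, hur, hgu⟩ := hs.exists_pred hsB
    exact ⟨u, by simpa [R, hu] using hur, by simp [f, hgu]⟩
  have hinj := Finset.injOn_of_surjOn_of_card_le f hmaps hsurj le_rfl
  exact hinj (by simpa [R, h₁] using hg₁) (by simpa [R, h₂] using hg₂) (by simp [f, hs₁, hs₂])

/-- The product of the numbers of transitions along the tree `t` with root `r`. -/
def treeWeight (N : α → α → ℕ) (B : Finset α) (r : α) (t : α → Option α) : ℕ :=
  ∏ v ∈ B.erase r, (t v).elim 0 (N v)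

variable [Fintype α]

open Classical in
/-- The spanning trees of `B` with root `r`. -/
noncomputable def exitTrees (B : Finset α) (r : α) : Finset (α → Option α) :=
  Finset.univ.filter (IsExitTree B r)

theorem mem_exitTrees {B : Finset α} {r : α} {t : α → Option α} :
    t ∈ exitTrees B r ↔ IsExitTree B r t := by simp [exitTrees]

open Classical in
/-- The maps of `B` to itself under which all of `B` reaches `r`. -/
noncomputable def recurrentMaps (B : Finset α) (r : α) : Finset (α → Option α) :=
  Finset.univ.filter (IsRecurrentMap B r)

theorem mem_recurrentMaps {B : Finset α} {r : α} {g : α → Option α} :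
    g ∈ recurrentMaps B r ↔ IsRecurrentMap B r g := by simp [recurrentMaps]

/-- The product of the numbers of transitions along `g`. -/
def mapWeight (N : α → α → ℕ) (B : Finset α) (g : α → Option α) : ℕ :=
  ∏ v ∈ B, (g v).elim 0 (N v)

/-- Adding the exit from `s` to `u` turns a tree rooted at `s` into a map whose cycle passes through
`s`; deleting the exit is the inverse, and the weight gains the factor `N s u`. -/
theorem mul_sum_treeWeight (N : α → α → ℕ) {B : Finset α} {s u : α} (hs : s ∈ B) (hu : u ∈ B)
    (ψ : (α → Option α) → ℕ) :
    N s u * ∑ t ∈ exitTrees B s, treeWeight N B s t * ψ (Function.update t s (some u)) =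
      ∑ g ∈ recurrentMaps B s with g s = some u, mapWeight N B g * ψ g := by
  rw [Finset.mul_sum]
  refine Finset.sum_nbij' (fun t => Function.update t s (some u))
    (fun g => Function.update g s none) ?_ ?_ ?_ ?_ ?_
  · intro t ht
    rw [mem_exitTrees] at ht
    simpa [mem_recurrentMaps] using ht.update hs hu
  · intro g hg
    rw [Finset.mem_filter, mem_recurrentMaps] at hg
    simpa [mem_exitTrees] using hg.1.update
  · intro t ht
    rw [mem_exitTrees] at ht
    simp [← ht.root]
  · intro g hg
    rw [Finset.mem_filter, mem_recurrentMaps] at hg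
    simp [← hg.2]
  · intro t ht
    rw [← mul_assoc]
    congr 1
    unfold mapWeight treeWeight
    rw [← Finset.mul_prod_erase B _ hs]
    congr 1
    · simp
    · refine Finset.prod_congr rfl fun v hv => ?_
      rw [Function.update_of_ne (Finset.ne_of_mem_erase hv)]

/-- The one-step identity of the tree-valued chain. -/
theorem sum_treeWeight_step {N : α → α → ℕ} {B : Finset α} (hN : ∀ a b, 0 < N a b → b ∈ B)
    {s' : α} (hs' : s' ∈ B) (φ : (α → Option α) → ℕ) :
    (∑ u, N s' u) * ∑ t ∈ exitTrees B s', treeWeight N B s' t * φ t =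
      ∑ s ∈ B, N s s' * ∑ t ∈ exitTrees B s, treeWeight N B s t *
        φ (Function.update (Function.update t s (some s')) s' none) := by
  classical
  -- Both sides are sums over the maps `g` whose cycle contains `s'`. The left side sorts them by
  -- the exit `u` from `s'`, the right side by the predecessor `s` of `s'` on the cycle; each `g`
  -- has exactly one of either.
  have h1 : ∑ u, N s' u = ∑ u ∈ B, N s' u := by
    refine (Finset.sum_subset (Finset.subset_univ B) fun u _ hu => ?_).symm
    by_contra h
    exact hu (hN s' u (Nat.pos_of_ne_zero h))
  have h2 : ∀ u ∈ B, N s' u * ∑ t ∈ exitTrees B s', treeWeight N B s' t * φ t =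
      ∑ g ∈ recurrentMaps B s' with g s' = some u,
        mapWeight N B g * φ (Function.update g s' none) := by
    intro u hu
    rw [← mul_sum_treeWeight N hs' hu]
    congr 1
    refine Finset.sum_congr rfl fun t ht => ?_
    rw [mem_exitTrees] at ht
    simp [← ht.root]
  rw [h1, Finset.sum_mul, Finset.sum_congr rfl h2,
    Finset.sum_congr rfl fun s hs => mul_sum_treeWeight N hs hs'
      fun g => φ (Function.update g s' none)]
  simp only [Finset.sum_filter]
  have h3 : ∀ (p : (α → Option α) → α → Prop) [∀ g s, Decidable (p g s)] (F : (α → Option α) → ℕ)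
      (r : α), ∑ g ∈ recurrentMaps B r, (if p g r then F g else 0) =
        ∑ g, if IsRecurrentMap B r g ∧ p g r then F g else 0 := by
    intro p _ F r
    simp [recurrentMaps, Finset.sum_filter, ite_and]
  have h4 : ∀ s ∈ B, ∑ g ∈ recurrentMaps B s, (if g s = some s' then
      mapWeight N B g * φ (Function.update g s' none) else 0) =
      ∑ g, if IsRecurrentMap B s g ∧ g s = some s' then
        mapWeight N B g * φ (Function.update g s' none) else 0 := fun s _ =>
    h3 (fun g s => g s = some s') _ s
  have h5 : ∀ u ∈ B, ∑ g ∈ recurrentMaps B s', (if g s' = some u then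
      mapWeight N B g * φ (Function.update g s' none) else 0) =
      ∑ g, if IsRecurrentMap B s' g ∧ g s' = some u then
        mapWeight N B g * φ (Function.update g s' none) else 0 := fun u _ =>
    h3 (fun g _ => g s' = some u) _ s'
  rw [Finset.sum_congr rfl h4, Finset.sum_congr rfl h5, Finset.sum_comm,
    Finset.sum_comm (s := B)]
  refine Finset.sum_congr rfl fun g _ => ?_
  by_cases hg : IsRecurrentMap B s' g
  · obtain ⟨u, hu, hgu⟩ := hg.on s' hs'
    obtain ⟨s, hs, hsg, hgs⟩ := hg.exists_pred hs'
    rw [Finset.sum_eq_single u, Finset.sum_eq_single s, if_pos ⟨hg, hgu⟩, if_pos ⟨hsg, hgs⟩]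
    · exact fun b hb hbs => if_neg fun h => hbs (h.1.pred_unique hb hs hsg h.2 hgs)
    · exact fun h => absurd hs h
    · exact fun b _ hbu => if_neg fun h => hbu (Option.some.inj (h.2.symm.trans hgu))
    · exact fun h => absurd hu h
  · rw [Finset.sum_eq_zero fun u _ => if_neg fun h => hg h.1,
      Finset.sum_eq_zero fun s _ => if_neg fun h => hg (h.1.succ h.2)]

/-- In a balanced connected graph the total weight of the spanning trees does not depend on the
root. -/
theorem sum_treeWeight_root {N : α → α → ℕ} {B : Finset α} (hN : ∀ a b, 0 < N a b → a ∈ B ∧ b ∈ B)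
    (hbal : ∀ a, ∑ b, N a b = ∑ b, N b a)
    (hconn : ∀ a ∈ B, ∀ b ∈ B, Relation.ReflTransGen (fun x y => 0 < N y x) a b)
    {r s : α} (hr : r ∈ B) (hs : s ∈ B) :
    ∑ t ∈ exitTrees B r, treeWeight N B r t = ∑ t ∈ exitTrees B s, treeWeight N B s t := by
  set Z : α → ℕ := fun s => ∑ t ∈ exitTrees B s, treeWeight N B s t with hZ
  obtain ⟨m, hm, hmax⟩ := Finset.exists_max_image B Z ⟨r, hr⟩
  have step : ∀ s' ∈ B, (∑ s ∈ B, N s s') * Z s' = ∑ s ∈ B, N s s' * Z s := by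
    intro s' hs'
    -- With constant `φ`, and balance replacing outgoing by incoming counts, `Z s'` is the weighted
    -- mean of `Z` over the predecessors of `s'`.
    have h := sum_treeWeight_step (fun a b h => (hN a b h).2) hs' (fun _ => 1)
    simp only [mul_one] at h
    rw [hbal, ← Finset.sum_subset (Finset.subset_univ B)] at h
    · exact h
    · intro u _ hu
      by_contra h0
      exact hu (hN u s' (Nat.pos_of_ne_zero h0)).1
  -- Maximum principle: a mean equal to the maximum forces every predecessor to attain it, and
  -- connectedness spreads this to `B`.
  have key : ∀ a ∈ B, Z a = Z m := by
    intro a ha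
    have := hconn m hm a ha
    induction this with
    | refl => rfl
    | tail _ h1 ih =>
      rename_i b c _
      have hb := (hN _ _ h1).2
      have ihb := ih hb
      by_contra hne
      have hlt : Z c < Z m := lt_of_le_of_ne (hmax c ha) hne
      have h2 : ∑ s ∈ B, N s b * Z s < ∑ s ∈ B, N s b * Z b := by
        refine Finset.sum_lt_sum (fun s hs => ?_) ⟨c, ha, ?_⟩
        · exact Nat.mul_le_mul_left _ (ihb ▸ hmax s hs)
        · exact Nat.mul_lt_mul_of_pos_left (ihb ▸ hlt) h1
      rw [← step b hb, Finset.sum_mul] at h2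
      exact lt_irrefl _ h2
  exact (key r hr).trans (key s hs).symm

end Trees

theorem ENNReal.eq_of_sum_eq_of_le {ι : Type*} {F : Finset ι} {f g : ι → ℝ≥0∞}
    (hle : ∀ i ∈ F, f i ≤ g i) (hsum : ∑ i ∈ F, f i = ∑ i ∈ F, g i) (hfin : ∑ i ∈ F, f i ≠ ∞)
    {i : ι} (hi : i ∈ F) : f i = g i := by
  classical
  refine le_antisymm (hle i hi) ?_
  rw [← Finset.add_sum_erase F f hi, ← Finset.add_sum_erase F g hi] at hsum
  rw [← Finset.add_sum_erase F f hi] at hfin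
  have h1 : ∑ j ∈ F.erase i, f j ≤ ∑ j ∈ F.erase i, g j :=
    Finset.sum_le_sum fun j hj => hle j (Finset.mem_of_mem_erase hj)
  have h2 : g i + ∑ j ∈ F.erase i, f j ≤ f i + ∑ j ∈ F.erase i, f j := by
    rw [hsum]
    gcongr
  exact (ENNReal.add_le_add_iff_right (ENNReal.add_ne_top.1 hfin).2).1 h2

/-- Paths to the members of `L` in turn are glued together; the result serves as a covering route
for the backward walk. -/
theorem exists_covering_chain {α : Type*} {R : α → α → Prop} {B : Set α}
    (hconn : ∀ a ∈ B, ∀ b ∈ B, Relation.ReflTransGen R a b) (L : List α) (hL : ∀ a ∈ L, a ∈ B)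
    {s : α} (hs : s ∈ B) : ∃ q, List.IsChain R (s :: q) ∧ ∀ a ∈ L, a ∈ s :: q := by
  induction L generalizing s with
  | nil => exact ⟨[], by simp, by simp⟩
  | cons a L ih =>
    have ha : a ∈ B := hL a (by simp)
    obtain ⟨q, hq, hqL⟩ := ih (fun b hb => hL b (by simp [hb])) ha
    obtain ⟨p, hp, hpa⟩ := List.exists_isChain_cons_of_relationReflTransGen (hconn s hs a ha)
    refine ⟨p ++ q, ?_, ?_⟩
    · rw [← List.cons_append]
      refine List.IsChain.append hp (List.IsChain.tail hq) ?_
      intro x hx y hy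
      rw [List.getLast?_eq_some_getLast (by simp), hpa] at hx
      obtain rfl : a = x := by simpa using hx
      cases q with
      | nil => simp at hy
      | cons z q =>
        obtain rfl : z = y := by simpa using hy
        simpa using hq.rel
    · have hm : a ∈ s :: p := hpa ▸ List.getLast_mem _
      intro b hb
      rw [← List.cons_append, List.mem_append]
      rcases List.mem_cons.1 hb with rfl | hb
      · exact Or.inl hm
      · rcases List.mem_cons.1 (hqL b hb) with rfl | h
        · exact Or.inl hm
        · exact Or.inr h

/-! ### The closed transition graph: balanced and strongly connected. -/

section ClosedPairCount

variable {α : Type u} [Fintype α] [DecidableEq α]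

/-- The closing transition supplies the exit that the last entry lacks. The same holds for
entrances, so both degrees of a value equal its number of occurrences. -/
theorem sum_closedPairCount_right (ξ : List α) (a : α) :
    ∑ b, closedPairCount ξ a b = ξ.count a := by
  rw [← sum_pairCount_right ξ a]
  cases ξ with
  | nil => simp [closedPairCount, pairCount_nil]
  | cons x ξ =>
    simp only [closedPairCount, Finset.sum_add_distrib, List.head?_cons, Option.some_inj, ite_and]
    by_cases h : (x :: ξ).getLast? = some a <;> simp [h, add_comm]

theorem sum_closedPairCount_left (ξ : List α) (b : α) :
    ∑ a, closedPairCount ξ a b = ξ.count b := by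
  rw [← sum_pairCount_left ξ b]
  rcases ξ.eq_nil_or_concat with rfl | ⟨p, x, rfl⟩
  · simp [closedPairCount, pairCount_nil]
  · simp only [closedPairCount, Finset.sum_add_distrib, List.concat_eq_append,
      List.getLast?_concat, Option.some_inj, ite_and]
    by_cases h : (p ++ [x]).head? = some b <;> simp [h, add_comm]

theorem mem_of_closedPairCount_pos {ξ : List α} {a b : α} (h : 0 < closedPairCount ξ a b) :
    a ∈ ξ ∧ b ∈ ξ := by
  constructor
  · rw [← List.count_pos_iff, ← sum_closedPairCount_right]
    exact h.trans_le (Finset.single_le_sum (f := fun b => closedPairCount ξ a b)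
      (fun _ _ => zero_le) (Finset.mem_univ b))
  · rw [← List.count_pos_iff, ← sum_closedPairCount_left]
    exact h.trans_le (Finset.single_le_sum (f := fun a => closedPairCount ξ a b)
      (fun _ _ => zero_le) (Finset.mem_univ a))

omit [Fintype α] in
theorem isChain_pairCount (ξ : List α) : ξ.IsChain fun a b => 0 < pairCount ξ a b := by
  induction ξ with
  | nil => simp
  | cons x ξ ih =>
    cases ξ with
    | nil => simp
    | cons y ξ =>
      refine List.IsChain.cons_cons (by simp [pairCount_cons_cons]) (ih.imp fun a b h => ?_)
      rw [pairCount_cons_cons]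
      omega

omit [Fintype α] in
-- Along `ξ` one gets from `b` to the end, by the closing transition to the head, and then on to
-- `a`; the relation is this route reversed.
theorem closedPairCount_reaches {ξ : List α} {a b : α} (ha : a ∈ ξ) (hb : b ∈ ξ) :
    Relation.ReflTransGen (fun x y => 0 < closedPairCount ξ y x) a b := by
  suffices h : Relation.ReflTransGen (fun x y => 0 < closedPairCount ξ x y) b a from
    (Relation.reflTransGen_swap.2 h)
  have hne : ξ ≠ [] := List.ne_nil_of_mem ha
  have hchain : ξ.IsChain fun a b => 0 < closedPairCount ξ a b :=
    (isChain_pairCount ξ).imp fun a b h => by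
      unfold closedPairCount
      omega
  have h1 : Relation.ReflTransGen (fun x y => 0 < closedPairCount ξ x y) b (ξ.getLast hne) :=
    List.IsChain.backwards_induction (fun c => Relation.ReflTransGen _ c (ξ.getLast hne)) ξ hchain
      (fun _ _ h₁ h₂ => .head h₁ h₂) (fun _ => .refl) b hb
  have h2 : Relation.ReflTransGen (fun x y => 0 < closedPairCount ξ x y) (ξ.head hne) a :=
    List.IsChain.induction (Relation.ReflTransGen _ (ξ.head hne) ·) ξ hchain
      (fun _ _ h₁ h₂ => .tail h₂ h₁) (fun _ => .refl) a ha
  refine (h1.tail ?_).trans h2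
  simp [closedPairCount, List.getLast?_eq_some_getLast hne, List.head?_eq_some_head hne]

end ClosedPairCount

/-! ### The backward walk halts and draws a weighted spanning tree. -/

section BackwardWalk

variable {α : Type u} [Fintype α] [DecidableEq α]

/-- The states of the backward walk along `ξ` from `r`. -/
structure IsBackwardWalk (ξ : List α) (r : α) (ζ : List α) : Prop where
  head : ζ.head? = some r
  mem : ∀ a ∈ ζ, a ∈ ξ
  step : ∀ u v, 0 < pairCount ζ u v → 0 < closedPairCount ξ v u

omit [Fintype α] in
theorem IsBackwardWalk.exists_last {ξ ζ : List α} {r : α} (h : IsBackwardWalk ξ r ζ) :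
    ∃ s', ζ.getLast? = some s' ∧ s' ∈ ζ := by
  have hne : ζ ≠ [] := by
    rintro rfl
    simpa using h.head
  exact ⟨_, List.getLast?_eq_some_getLast hne, List.getLast_mem hne⟩

theorem IsBackwardWalk.concat {ξ ζ : List α} {r s s' : α} (h : IsBackwardWalk ξ r ζ)
    (hs' : ζ.getLast? = some s') (hs : 0 < closedPairCount ξ s s') :
    IsBackwardWalk ξ r (ζ ++ [s]) where
  head := by
    have hne : ζ ≠ [] := by
      rintro rfl
      simp at hs'
    rw [List.head?_append_of_ne_nil _ hne, h.head]
  mem a ha := by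
    rcases List.mem_append.1 ha with ha | ha
    · exact h.mem a ha
    · rw [List.mem_singleton.1 ha]
      exact (mem_of_closedPairCount_pos hs).1
  step u v huv := by
    rw [pairCount_concat] at huv
    by_cases h0 : 0 < pairCount ζ u v
    · exact h.step u v h0
    · by_cases h1 : ζ.getLast? = some u ∧ s = v
      · rw [hs', Option.some_inj] at h1
        rwa [← h1.1, ← h1.2]
      · simp [h1] at huv
        omega

omit [Fintype α] in
theorem IsBackwardWalk.singleton {ξ : List α} {r : α} (hr : r ∈ ξ) : IsBackwardWalk ξ r [r] where
  head := by simp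
  mem a ha := by rwa [List.mem_singleton.1 ha]
  step u v huv := by simp [pairCount_singleton] at huv

/-- The result of a round of the backward walk that draws `s`. -/
def backwardResult (ξ ζ : List α) (s : α) : List α ⊕ List α :=
  if ∀ a ∈ ξ, a ∈ ζ ++ [s] then Sum.inr (ζ ++ [s]) else Sum.inl (ζ ++ [s])

theorem backwardRound_eq {ξ ζ : List α} {s' : α} (hs' : ζ.getLast? = some s') :
    backwardRound ξ ζ = Law.bind (Law.draw fun s => closedPairCount ξ s s') fun s =>
      Law.pure (backwardResult ξ ζ s) := by
  simp only [backwardRound, hs', backwardResult]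
  congr 1
  funext s
  split_ifs <;> rfl

theorem tsum_backwardRound_mul {ξ ζ : List α} {s' : α} (hs' : ζ.getLast? = some s')
    (F : List α ⊕ List α → ℝ≥0∞) :
    ∑' r, backwardRound ξ ζ r * F r =
      ∑ s, (closedPairCount ξ s s' : ℝ≥0∞) / (ξ.count s' : ℕ) * F (backwardResult ξ ζ s) := by
  rw [backwardRound_eq hs', Law.tsum_bind_mul, tsum_fintype]
  simp only [Law.tsum_pure_mul, Law.draw, sum_closedPairCount_left]

theorem exists_of_backwardRound_ne_zero {ξ ζ : List α} {s' : α} (hs' : ζ.getLast? = some s')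
    {r : List α ⊕ List α} (hr : backwardRound ξ ζ r ≠ 0) :
    ∃ s, 0 < closedPairCount ξ s s' ∧ r = backwardResult ξ ζ s := by
  classical
  by_contra! h
  apply hr
  rw [backwardRound_eq hs', Law.bind]
  refine ENNReal.tsum_eq_zero.2 fun s => ?_
  rcases Nat.eq_zero_or_pos (closedPairCount ξ s s') with h0 | h0
  · simp [Law.draw, h0]
  · simp [Law.pure_apply, h s h0]

theorem backwardRound_inl {ξ ζ ζ' : List α} {r : α} (h : IsBackwardWalk ξ r ζ)
    (h0 : backwardRound ξ ζ (Sum.inl ζ') ≠ 0) : IsBackwardWalk ξ r ζ' := by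
  obtain ⟨s', hs', -⟩ := h.exists_last
  obtain ⟨s, hs, he⟩ := exists_of_backwardRound_ne_zero hs' h0
  unfold backwardResult at he
  split_ifs at he
  rw [Sum.inl.inj he]
  exact h.concat hs' hs

theorem backwardRound_inr {ξ ζ ζ' : List α} {r : α} (h : IsBackwardWalk ξ r ζ)
    (h0 : backwardRound ξ ζ (Sum.inr ζ') ≠ 0) :
    IsBackwardWalk ξ r ζ' ∧ ∀ a ∈ ξ, a ∈ ζ' := by
  obtain ⟨s', hs', -⟩ := h.exists_last
  obtain ⟨s, hs, he⟩ := exists_of_backwardRound_ne_zero hs' h0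
  unfold backwardResult at he
  split_ifs at he with hc
  rw [Sum.inr.inj he]
  exact ⟨h.concat hs' hs, hc⟩

theorem backwardWalk_support {ξ ζ : List α} {r : α} (hr : ξ.getLast? = some r)
    (h0 : backwardWalk ξ ζ ≠ 0) : IsBackwardWalk ξ r ζ ∧ ∀ a ∈ ξ, a ∈ ζ := by
  simp only [backwardWalk, hr] at h0
  exact Law.loop_support (Inv := IsBackwardWalk ξ r) (fun _ _ h h0 => backwardRound_inl h h0)
    (Post := fun ζ => IsBackwardWalk ξ r ζ ∧ ∀ a ∈ ξ, a ∈ ζ)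
    (fun _ _ h h0 => backwardRound_inr h h0)
    (IsBackwardWalk.singleton (List.mem_of_getLast? hr)) h0

theorem tsum_backwardRound {ξ ζ : List α} {r : α} (h : IsBackwardWalk ξ r ζ) :
    ∑' x, backwardRound ξ ζ x = 1 := by
  obtain ⟨s', hs', hm⟩ := h.exists_last
  have := tsum_backwardRound_mul hs' (ξ := ξ) 1
  simp only [Pi.one_apply, mul_one, div_eq_mul_inv] at this
  rw [this, ← Finset.sum_mul, ← Nat.cast_sum, sum_closedPairCount_left]
  exact ENNReal.mul_inv_cancel (by exact_mod_cast (List.count_pos_iff.2 (h.mem s' hm)).ne')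
    (ENNReal.natCast_ne_top _)

/-- A possible path that covers `ξ` gives a lower bound for the probability of halting. -/
theorem le_tsum_loopWithin_backwardRound {ξ : List α} (q : List α) (hq : q ≠ []) {ζ : List α}
    {s' : α} (hs' : ζ.getLast? = some s')
    (hc : List.IsChain (fun x y => 0 < closedPairCount ξ y x) (s' :: q))
    (hcov : ∀ a ∈ ξ, a ∈ ζ ++ q) :
    (ξ.length : ℝ≥0∞)⁻¹ ^ q.length ≤ ∑' b, Law.loopWithin (backwardRound ξ) q.length ζ b := by
  induction q generalizing ζ s' with
  | nil => exact absurd rfl hq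
  | cons s q ih =>
    have e := Law.tsum_loopWithin_succ_mul (backwardRound ξ) q.length ζ 1
    simp only [Pi.one_apply, mul_one] at e
    rw [List.length_cons, e, tsum_backwardRound_mul hs', pow_succ']
    refine le_trans ?_ (Finset.single_le_sum (fun _ _ => zero_le) (Finset.mem_univ s))
    have hpos : 0 < closedPairCount ξ s s' := hc.rel
    refine mul_le_mul' ?_ ?_
    -- A possible step has count at least one out of `ξ.count s' ≤ ξ.length`. If `ξ` is covered
    -- before `q` is used up, the loop is left at once and the unused factors are at most one.
    · rw [← one_div]
      refine ENNReal.div_le_div (by exact_mod_cast hpos) ?_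
      exact_mod_cast List.count_le_length
    · have hδ : (ξ.length : ℝ≥0∞)⁻¹ ≤ 1 := by
        rw [ENNReal.inv_le_one]
        exact_mod_cast List.length_pos_of_mem (mem_of_closedPairCount_pos hpos).1
      unfold backwardResult
      split_ifs with h
      · exact pow_le_one₀ zero_le hδ
      · refine ih ?_ (s' := s) (by simp) hc.tail (by simpa using hcov)
        rintro rfl
        exact h hcov

theorem tsum_backwardWalk {ξ : List α} (hξ : ξ ≠ []) : ∑' ζ, backwardWalk ξ ζ = 1 := by
  have hr := List.getLast?_eq_some_getLast hξ
  set r := ξ.getLast hξ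
  simp only [backwardWalk, hr]
  have hq : ∀ s : {s // s ∈ ξ}, ∃ q : List α, q ≠ [] ∧
      List.IsChain (fun x y => 0 < closedPairCount ξ y x) (s.1 :: q) ∧
      ∀ a ∈ ξ, a ∈ s.1 :: q := by
    rintro ⟨s, hs⟩
    -- Coverage is tested only after a draw, so the route must contain at least one step; `u`
    -- provides it.
    obtain ⟨u, hu⟩ : ∃ u, 0 < closedPairCount ξ u s := by
      by_contra! h
      have h1 := sum_closedPairCount_left ξ s
      rw [Finset.sum_eq_zero fun u _ => Nat.le_zero.1 (h u)] at h1
      exact (List.count_pos_iff.2 hs).ne h1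
    obtain ⟨q, hq, hcov⟩ := exists_covering_chain (B := {a | a ∈ ξ})
      (fun a ha b hb => closedPairCount_reaches (ξ := ξ) ha hb) ξ (fun a ha => ha)
      (mem_of_closedPairCount_pos hu).1
    exact ⟨u :: q, by simp, List.IsChain.cons_cons hu hq,
      fun a ha => List.mem_cons_of_mem _ (hcov a ha)⟩
  choose Q hQne hQc hQcov using hq
  have hδ : (ξ.length : ℝ≥0∞)⁻¹ ≤ 1 := by
    rw [ENNReal.inv_le_one]
    exact_mod_cast List.length_pos_of_ne_nil hξ
  refine Law.tsum_loop_eq_one (Inv := IsBackwardWalk ξ r) (fun _ _ h h0 => backwardRound_inl h h0)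
    (fun _ h => tsum_backwardRound h) (Finset.univ.sup fun s => (Q s).length)
    (ε := (ξ.length : ℝ≥0∞)⁻¹ ^ (Finset.univ.sup fun s => (Q s).length)) ?_ ?_
    (IsBackwardWalk.singleton (List.mem_of_getLast? hr))
  · exact pow_ne_zero _ (ENNReal.inv_ne_zero.2 (ENNReal.natCast_ne_top _))
  · intro ζ h
    obtain ⟨s', hs', hm⟩ := h.exists_last
    have hle : (Q ⟨s', h.mem s' hm⟩).length ≤ Finset.univ.sup fun s => (Q s).length :=
      Finset.le_sup (f := fun s => (Q s).length) (Finset.mem_univ _)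
    calc _ ≤ (ξ.length : ℝ≥0∞)⁻¹ ^ (Q ⟨s', h.mem s' hm⟩).length :=
          pow_le_pow_of_le_one zero_le hδ hle
      _ ≤ _ := le_tsum_loopWithin_backwardRound _ (hQne _) hs'
          (hQc ⟨s', h.mem s' hm⟩) fun a ha => by
          rcases List.mem_cons.1 (hQcov ⟨s', h.mem s' hm⟩ a ha) with rfl | h'
          · exact List.mem_append_left _ hm
          · exact List.mem_append_right _ h'
      _ ≤ _ := ENNReal.tsum_le_tsum fun b => Law.monotone_loopWithin _ _ b hle

/-- The exit tree that results when the backward walk `ζ` is prolonged by a walk whose exit tree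
is `t`. -/
def extendExit (ζ : List α) (t : α → Option α) (v : α) : Option α :=
  if v ∈ ζ then lastExit ζ v else t v

omit [Fintype α] in
-- The step from `s'` to `s` can be charged to the walk or to its continuation. In the latter case
-- `s` gets the exit `s'`, and `s'` becomes the root. This is the tree operation in
-- `sum_treeWeight_step`.
theorem extendExit_concat {ζ : List α} {s s' : α} (hs' : ζ.getLast? = some s')
    (t : α → Option α) : extendExit (ζ ++ [s]) t =
      extendExit ζ (Function.update (Function.update t s (some s')) s' none) := by
  funext v
  have hm : s' ∈ ζ := List.mem_of_getLast? hs'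
  simp only [extendExit, List.mem_append, List.mem_singleton, lastExit_concat, hs']
  by_cases hv : v ∈ ζ
  · simp [hv]
  · have hvs' : v ≠ s' := fun h => hv (h ▸ hm)
    by_cases hvs : v = s
    · subst hvs
      simp [hv, hvs']
    · simp [hv, hvs, hvs']

/-- The number of ways to end up with the exit tree `t` after the walk `ζ`. -/
noncomputable def exitCount (ξ ζ : List α) (t : α → Option α) : ℕ :=
  ζ.getLast?.elim 0 fun s => ∑ t₀ ∈ exitTrees ξ.toFinset s,
    treeWeight (closedPairCount ξ) ξ.toFinset s t₀ * if extendExit ζ t₀ = t then 1 else 0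

/-- Harmonicity of `exitCount` along the backward walk: `sum_treeWeight_step` for the indicator of
`extendExit ζ t₀ = t`. -/
theorem sum_mul_exitCount {ξ ζ : List α} {s' : α} (hs' : ζ.getLast? = some s') (hm : s' ∈ ξ)
    (t : α → Option α) :
    ∑ s, closedPairCount ξ s s' * exitCount ξ (ζ ++ [s]) t =
      ξ.count s' * exitCount ξ ζ t := by
  have h := sum_treeWeight_step (N := closedPairCount ξ) (B := ξ.toFinset)
    (fun a b h => List.mem_toFinset.2 (mem_of_closedPairCount_pos h).2) (List.mem_toFinset.2 hm)
    fun t₀ => if extendExit ζ t₀ = t then 1 else 0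
  rw [sum_closedPairCount_right] at h
  simp only [exitCount, hs', List.getLast?_concat, Option.elim_some, extendExit_concat hs']
  rw [h]
  refine (Finset.sum_subset (Finset.subset_univ _) fun s _ hs => ?_).symm
  have : closedPairCount ξ s s' = 0 := by
    by_contra h0
    exact hs (List.mem_toFinset.2 (mem_of_closedPairCount_pos (Nat.pos_of_ne_zero h0)).1)
  rw [this, zero_mul]

/-- The total weight of the trees with root `r`. -/
noncomputable def totalWeight (ξ : List α) (r : α) : ℕ :=
  ∑ t ∈ exitTrees ξ.toFinset r, treeWeight (closedPairCount ξ) ξ.toFinset r t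

/-- After coverage the continuation no longer affects the exits. What remains is the total weight of
the trees rooted at the current end of `ζ`, and by `sum_treeWeight_root` the root may be replaced by
`r`. -/
theorem exitCount_of_covers {ξ ζ : List α} {r : α} (hr : r ∈ ξ) (h : IsBackwardWalk ξ r ζ)
    (hcov : ∀ a ∈ ξ, a ∈ ζ) (t : α → Option α) :
    exitCount ξ ζ t = totalWeight ξ r * if lastExit ζ = t then 1 else 0 := by
  obtain ⟨s', hs', hm⟩ := h.exists_last
  have hs'ξ := h.mem s' hm
  simp only [exitCount, hs', Option.elim_some, totalWeight]
  rw [sum_treeWeight_root (fun a b h => ?_) (fun a => ?_) (fun a ha b hb => ?_)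
    (List.mem_toFinset.2 hr) (List.mem_toFinset.2 hs'ξ), Finset.sum_mul]
  · refine Finset.sum_congr rfl fun t₀ ht₀ => ?_
    rw [mem_exitTrees] at ht₀
    have : extendExit ζ t₀ = lastExit ζ := by
      funext v
      unfold extendExit
      split_ifs with hv
      · rfl
      · rw [lastExit_of_notMem hv, ht₀.off v fun hB => hv (hcov v (List.mem_toFinset.1 hB))]
    rw [this]
  · simpa using mem_of_closedPairCount_pos h
  · rw [sum_closedPairCount_right, sum_closedPairCount_left]
  · exact closedPairCount_reaches (List.mem_toFinset.1 ha) (List.mem_toFinset.1 hb)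

omit [Fintype α] in
theorem isExitTree_lastExit {ξ ζ : List α} {r : α} (hr : ζ.head? = some r)
    (hmem : ∀ a, a ∈ ζ ↔ a ∈ ξ) : IsExitTree ξ.toFinset r (lastExit ζ) where
  off v hv := lastExit_of_notMem fun h => hv (List.mem_toFinset.2 ((hmem v).1 h))
  root := lastExit_head hr
  reach v hv := lastExit_reaches_head hr ((hmem v).2 (List.mem_toFinset.1 hv))

theorem exitCount_singleton {ξ : List α} {r : α} {t : α → Option α}
    (ht : IsExitTree ξ.toFinset r t) :
    exitCount ξ [r] t = treeWeight (closedPairCount ξ) ξ.toFinset r t := by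
  simp only [exitCount, List.getLast?_singleton, Option.elim_some]
  rw [Finset.sum_eq_single t]
  · rw [if_pos, mul_one]
    funext v
    unfold extendExit
    split_ifs with hv
    · rw [List.mem_singleton.1 hv, lastExit_singleton, ht.root]
    · rfl
  · intro t₀ ht₀ hne
    rw [mem_exitTrees] at ht₀
    rw [if_neg, mul_zero]
    rintro rfl
    refine hne (funext fun v => ?_)
    unfold extendExit
    split_ifs with hv
    · rw [List.mem_singleton.1 hv, lastExit_singleton, ht₀.root]
    · rfl
  · exact fun h => absurd (mem_exitTrees.2 ht) h

/-- The exit tree of the backward walk is drawn with probability proportional to its weight. -/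
theorem tsum_backwardWalk_lastExit {ξ : List α} {r : α} (hr : ξ.getLast? = some r)
    {t : α → Option α} (ht : IsExitTree ξ.toFinset r t) :
    ∑' ζ, backwardWalk ξ ζ * (totalWeight ξ r * if lastExit ζ = t then 1 else 0) =
      (treeWeight (closedPairCount ξ) ξ.toFinset r t : ℝ≥0∞) := by
  have hrξ : r ∈ ξ := List.mem_of_getLast? hr
  have hξ : ξ ≠ [] := List.ne_nil_of_mem hrξ
  -- The harmonic function `exitCount` yields the upper bound, as its final value is the reward.
  have hle : ∀ t ∈ exitTrees ξ.toFinset r,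
      ∑' ζ, backwardWalk ξ ζ * (totalWeight ξ r * if lastExit ζ = t then 1 else 0) ≤
        (treeWeight (closedPairCount ξ) ξ.toFinset r t : ℝ≥0∞) := by
    intro t ht
    rw [← exitCount_singleton (mem_exitTrees.1 ht)]
    simp only [backwardWalk, hr]
    refine Law.tsum_loop_mul_le (Inv := IsBackwardWalk ξ r)
      (G := fun ζ => (exitCount ξ ζ t : ℝ≥0∞)) (fun _ _ h h0 => backwardRound_inl h h0)
      (fun ζ h => ?_) (IsBackwardWalk.singleton hrξ)
    obtain ⟨s', hs', hm⟩ := h.exists_last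
    have hs'ξ := h.mem s' hm
    rw [tsum_backwardRound_mul hs']
    have hc0 : (ξ.count s' : ℝ≥0∞) ≠ 0 := by
      exact_mod_cast (List.count_pos_iff.2 hs'ξ).ne'
    have hs := congrArg (Nat.cast : ℕ → ℝ≥0∞) (sum_mul_exitCount hs' hs'ξ t)
    push_cast at hs
    calc _ = ∑ s, (closedPairCount ξ s s' : ℝ≥0∞) * exitCount ξ (ζ ++ [s]) t /
          (ξ.count s' : ℕ) := by
          refine Finset.sum_congr rfl fun s _ => ?_
          rw [div_eq_mul_inv, div_eq_mul_inv, mul_right_comm]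
          rcases Nat.eq_zero_or_pos (closedPairCount ξ s s') with h0 | h0
          · simp [h0]
          · congr 2
            unfold backwardResult
            split_ifs with hcov
            · rw [exitCount_of_covers hrξ (h.concat hs' h0) hcov]
              push_cast
              rfl
            · rfl
      _ ≤ _ := by
          simp only [div_eq_mul_inv]
          rw [← Finset.sum_mul, hs, mul_right_comm,
            ENNReal.mul_inv_cancel hc0 (ENNReal.natCast_ne_top _), one_mul]
  -- Summed over all trees, both sides equal `totalWeight ξ r`: the walk halts almost surely, and
  -- its exits form exactly one tree. Hence no inequality is strict.
  refine ENNReal.eq_of_sum_eq_of_le hle ?_ ?_ (mem_exitTrees.2 ht)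
  all_goals
    have hsum : ∑ t ∈ exitTrees ξ.toFinset r, ∑' ζ, backwardWalk ξ ζ *
        (totalWeight ξ r * if lastExit ζ = t then 1 else 0) = (totalWeight ξ r : ℝ≥0∞) := by
      rw [← Summable.tsum_finsetSum fun _ _ => ENNReal.summable]
      calc _ = ∑' ζ, backwardWalk ξ ζ * (totalWeight ξ r : ℝ≥0∞) := by
            refine tsum_congr fun ζ => ?_
            by_cases h0 : backwardWalk ξ ζ = 0
            · simp [h0]
            · obtain ⟨h, hcov⟩ := backwardWalk_support hr h0
              have : lastExit ζ ∈ exitTrees ξ.toFinset r :=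
                mem_exitTrees.2 (isExitTree_lastExit h.head fun a => ⟨h.mem a, hcov a⟩)
              simp [this]
        _ = _ := by rw [ENNReal.tsum_mul_right, tsum_backwardWalk hξ, one_mul]
  · rw [hsum, totalWeight]
    push_cast
    rfl
  · rw [hsum]
    exact ENNReal.natCast_ne_top _

end BackwardWalk

/-! ### The forward walk completes, and all orders of the transitions are equally likely. -/

section ForwardWalk

variable {α : Type u} [DecidableEq α]

/-- The transitions still to be made: those in `N`, and the last exits from the values in `U`. -/
def remaining (e : α → Option α) (N : α → α → ℕ) (U : Finset α) (a b : α) : ℕ :=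
  N a b + if a ∈ U ∧ e a = some b then 1 else 0

theorem remaining_pos {e : α → Option α} {N : α → α → ℕ} {U : Finset α} {a b : α} (ha : a ∈ U)
    (he : e a = some b) : 0 < remaining e N U a b := by
  simp [remaining, ha, he]

/-- `s :: l` uses the transitions in `remaining e N U`, and its last exits from the values in `U`
are those of `e`. -/
def IsCompletion (e : α → Option α) (N : α → α → ℕ) (U : Finset α) (s : α) (l : List α) : Prop :=
  pairCount (s :: l) = remaining e N U ∧ ∀ v ∈ U, lastExit (s :: l).reverse v = e v

theorem lastExit_reverse_cons_of_mem {s v : α} {p : List α} (hv : v ∈ p) :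
    lastExit (s :: p).reverse v = lastExit p.reverse v := by
  rw [List.reverse_cons, lastExit_concat, if_pos (List.mem_reverse.2 hv)]

theorem lastExit_reverse_cons_of_notMem {s : α} {p : List α} (hs : s ∉ p) :
    lastExit (s :: p).reverse s = p.head? := by
  rw [List.reverse_cons, lastExit_concat, if_neg (by simpa using hs), if_pos rfl,
    List.getLast?_reverse]

variable [Fintype α]

/-- The degrees of `M` are those of a trail from `s` to `r` with `m` transitions. -/
structure HasTrailDegrees (M : α → α → ℕ) (r s : α) (m : ℕ) : Prop where
  balance : ∀ v, ∑ b, M v b + (if v = r then 1 else 0) = ∑ b, M b v + if v = s then 1 else 0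
  total : ∑ a, ∑ b, M a b = m

theorem HasTrailDegrees.step {M M' : α → α → ℕ} {r s c : α} {m : ℕ}
    (h : HasTrailDegrees M r s (m + 1))
    (hM : ∀ a b, M a b = (if s = a ∧ c = b then 1 else 0) + M' a b) :
    HasTrailDegrees M' r c m where
  balance v := by
    have h1 := h.balance v
    simp only [hM, Finset.sum_add_distrib, ite_and] at h1
    by_cases h2 : s = v <;> by_cases h3 : c = v <;>
      simp [h2, h3, eq_comm (a := v)] at h1 ⊢ <;> omega
  total := by
    have h1 := h.total
    simp only [hM, Finset.sum_add_distrib, ite_and] at h1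
    simp at h1
    omega

theorem HasTrailDegrees.getLast?_eq {M : α → α → ℕ} {r s : α} {m : ℕ}
    (h : HasTrailDegrees M r s m) {l : List α} (hl : pairCount (s :: l) = M) :
    (s :: l).getLast? = some r := by
  have h1 := h.balance r
  have h2 := sum_pairCount_right (s :: l) r
  have h3 := sum_pairCount_left (s :: l) r
  rw [hl] at h2 h3
  by_contra hne
  simp only [hne, if_false, if_true, List.head?_cons, Option.some_inj, eq_comm (a := s)] at h1 h2 h3
  omega

/-- The states of the forward walk. -/
structure IsForwardState (e : α → Option α) (r : α) (N : α → α → ℕ) (U : Finset α) (s : α)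
    (m : ℕ) : Prop where
  degrees : HasTrailDegrees (remaining e N U) r s m
  reach : ∀ v ∈ U, Relation.ReflTransGen (fun a b => e a = some b) v r
  root : r ∉ U
  exhausted : ∀ v, v ∉ U → v ≠ r → ∀ b, N v b = 0

section

variable {e : α → Option α} {r s : α} {N : α → α → ℕ} {U : Finset α} {m : ℕ}

theorem IsForwardState.exists_exit (h : IsForwardState e r N U s m) {v : α} (hv : v ∈ U) :
    ∃ u, e v = some u := by
  rcases (h.reach v hv).cases_head with h1 | ⟨u, hu, -⟩
  · exact absurd hv (h1 ▸ h.root)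
  · exact ⟨u, hu⟩

/-- The forward walk does not get stuck. -/
theorem IsForwardState.mem_of_row_eq_zero (h : IsForwardState e r N U s (m + 1))
    (h0 : ∑ b, N s b = 0) : s ∈ U := by
  by_contra hs
  have hrow : ∀ b, remaining e N U s b = 0 := by
    intro b
    have := Finset.sum_eq_zero_iff.1 h0 b (Finset.mem_univ b)
    simp [remaining, this, hs]
  -- A stuck walk has no exit left from `s`, so balance forces `s` to be the end `r`, and then no
  -- entrance to `s` is left either.
  have hsr : s = r := by
    by_contra hne
    have := h.degrees.balance s
    simp [hrow, hne] at this
  subst hsr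
  have hcol : ∀ b, remaining e N U b s = 0 := by
    have := h.degrees.balance s
    simp only [hrow, Finset.sum_const_zero, if_true] at this
    intro b
    exact Finset.sum_eq_zero_iff.1 (by omega : ∑ b, remaining e N U b s = 0) b (Finset.mem_univ b)
  have hU : ∀ v b, 0 < remaining e N U v b → v ∈ U := by
    intro v b hvb
    by_contra hv
    have hvs : v ≠ s := by
      rintro rfl
      exact hvb.ne' (hrow b)
    simp [remaining, hv, h.exhausted v hv hvs b] at hvb
  obtain ⟨v, hv⟩ : ∃ v, v ∈ U := by
    by_contra! hU'
    have := h.degrees.total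
    rw [Finset.sum_eq_zero] at this
    · omega
    · intro a _
      refine Finset.sum_eq_zero fun b _ => ?_
      by_contra h1
      exact hU' a (hU a b (Nat.pos_of_ne_zero h1))
  have hreach := h.reach v hv
  -- The tree path from `v` stays in `U`: each value on it can still be entered, so it is not `s`,
  -- and by balance it can still be left. But the path ends at `s`.
  have : s ∈ U := by
    clear hs
    induction hreach using Relation.ReflTransGen.head_induction_on with
    | refl => exact hv
    | head h1 _ ih =>
      rename_i a b _
      refine ih ?_
      have hpos : 0 < remaining e N U a b := remaining_pos hv h1
      have hb : b ≠ s := by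
        rintro rfl
        exact hpos.ne' (hcol a)
      have h2 := h.degrees.balance b
      simp only [hb, if_false, add_zero] at h2
      have h3 : 0 < ∑ c, remaining e N U b c := by
        rw [h2]
        exact hpos.trans_le (Finset.single_le_sum (f := fun a => remaining e N U a b)
          (fun _ _ => zero_le) (Finset.mem_univ a))
      obtain ⟨c, -, hc⟩ := Finset.exists_ne_zero_of_sum_ne_zero h3.ne'
      exact hU b c (Nat.pos_of_ne_zero hc)
  exact hs this

theorem mem_of_isCompletion (h : IsForwardState e r N U s m) {l : List α}
    (hl : pairCount (s :: l) = remaining e N U) {v : α} (hv : v ∈ U) : v ∈ s :: l := by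
  obtain ⟨u, hu⟩ := h.exists_exit hv
  exact mem_left_of_pairCount_pos (b := u) (hl ▸ remaining_pos hv hu)

/-- `N` after the transition from `s` to `c`. -/
abbrev removePair (N : α → α → ℕ) (s c : α) : α → α → ℕ :=
  fun a b => N a b - if (s, c) = (a, b) then 1 else 0

omit [Fintype α] in
theorem remaining_removePair {c : α} (hc : 0 < N s c) (a b : α) :
    remaining e N U a b = (if s = a ∧ c = b then 1 else 0) +
      remaining e (removePair N s c) U a b := by
  simp only [remaining, removePair, Prod.mk.injEq]
  by_cases h : s = a ∧ c = b
  · rw [← h.1, ← h.2]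
    simp only [and_self, if_true]
    omega
  · simp [h]

theorem IsForwardState.removePair {c : α} (h : IsForwardState e r N U s (m + 1)) (hc : 0 < N s c) :
    IsForwardState e r (removePair N s c) U c m where
  degrees := h.degrees.step fun a b => remaining_removePair hc a b
  reach := h.reach
  root := h.root
  exhausted v hv hvr b := by simp [_root_.removePair, h.exhausted v hv hvr b]

omit [Fintype α] in
theorem pairCount_cons_eq_iff {M M' : α → α → ℕ} {c : α} {l : List α}
    (hM : ∀ a b, M a b = (if s = a ∧ c = b then 1 else 0) + M' a b) :
    pairCount (s :: c :: l) = M ↔ pairCount (c :: l) = M' := by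
  constructor
  · intro h
    funext a b
    have := congrFun (congrFun h a) b
    rw [pairCount_cons_cons, hM] at this
    omega
  · intro h
    funext a b
    rw [pairCount_cons_cons, hM, h]

/-- A value in `U` still has its reserved exit ahead, so it occurs in `c :: l` and the present step
does not affect its last exit. -/
theorem isCompletion_removePair {c : α} (h : IsForwardState e r N U s (m + 1)) (hc : 0 < N s c)
    {l : List α} :
    IsCompletion e N U s (c :: l) ↔ IsCompletion e (removePair N s c) U c l := by
  unfold IsCompletion
  rw [pairCount_cons_eq_iff fun a b => remaining_removePair hc a b]
  refine and_congr_right fun hl => forall₂_congr fun v hv => ?_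
  rw [lastExit_reverse_cons_of_mem (mem_of_isCompletion (h.removePair hc) hl hv)]

omit [Fintype α] in
theorem remaining_erase {c : α} (hs : s ∈ U) (hc : e s = some c) (a b : α) :
    remaining e N U a b = (if s = a ∧ c = b then 1 else 0) +
      remaining e N (U.erase s) a b := by
  simp only [remaining]
  by_cases h : a = s
  · subst h
    simp [hs, hc, add_comm]
  · simp [h, Ne.symm h]

theorem IsForwardState.erase {c : α} (h : IsForwardState e r N U s (m + 1)) (hs : s ∈ U)
    (hc : e s = some c) (h0 : ∀ b, N s b = 0) : IsForwardState e r N (U.erase s) c m where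
  degrees := h.degrees.step fun a b => remaining_erase hs hc a b
  reach v hv := h.reach v (Finset.mem_of_mem_erase hv)
  root hr := h.root (Finset.mem_of_mem_erase hr)
  exhausted v hv hvr b := by
    by_cases hvs : v = s
    · rw [hvs, h0]
    · exact h.exhausted v (fun hU => hv (Finset.mem_erase.2 ⟨hvs, hU⟩)) hvr b

/-- Once the reserved exit is used, nothing leaves `s` any more. As `s` is not the end `r`, it does
not recur, so this step is its last exit. -/
theorem isCompletion_erase {c : α} (h : IsForwardState e r N U s (m + 1)) (hs : s ∈ U)
    (hc : e s = some c) (h0 : ∀ b, N s b = 0) {l : List α} :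
    IsCompletion e N U s (c :: l) ↔ IsCompletion e N (U.erase s) c l := by
  unfold IsCompletion
  rw [pairCount_cons_eq_iff fun a b => remaining_erase hs hc a b]
  refine and_congr_right fun hl => ?_
  have h' := h.erase hs hc h0
  have hsl : s ∉ c :: l := by
    rw [← List.count_eq_zero, ← sum_pairCount_right, hl, h'.degrees.getLast?_eq hl]
    have hsr : r ≠ s := by
      rintro rfl
      exact h.root hs
    simp [hsr, remaining, h0]
  constructor
  · intro hU v hv
    rw [← hU v (Finset.mem_of_mem_erase hv),
      lastExit_reverse_cons_of_mem (mem_of_isCompletion h' hl hv)]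
  · intro hU v hv
    by_cases hvs : v = s
    · rw [hvs, lastExit_reverse_cons_of_notMem hsl, hc, List.head?_cons]
    · have hv' := Finset.mem_erase.2 ⟨hvs, hv⟩
      rw [← hU v hv', lastExit_reverse_cons_of_mem (mem_of_isCompletion h' hl hv')]

/-- A completion does not use the last exit while other exits are left. -/
theorem pos_of_isCompletion {c : α} {l : List α} (h : IsCompletion e N U s (c :: l))
    (hrow : 0 < ∑ b, N s b) : 0 < N s c := by
  -- If `N s c = 0`, the pair `(s, c)` is available only once, as the reserved exit. Another exit
  -- from `s` is still due, so `s` recurs, and its last exit to `c` would use the pair a second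
  -- time.
  by_contra hc
  obtain ⟨hl, hU⟩ := h
  have hsc := congrFun (congrFun hl s) c
  rw [pairCount_cons_cons] at hsc
  simp only [remaining, and_self, if_true] at hsc
  have h1 : s ∈ U ∧ e s = some c := by
    by_contra h1
    simp only [h1, if_false] at hsc
    omega
  obtain ⟨b, -, hb⟩ := Finset.exists_ne_zero_of_sum_ne_zero hrow.ne'
  have hbc : b ≠ c := by
    rintro rfl
    omega
  have hsb := congrFun (congrFun hl s) b
  rw [pairCount_cons_cons] at hsb
  have hmem : s ∈ c :: l := by
    refine mem_left_of_pairCount_pos (b := b) ?_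
    simp only [remaining, hbc.symm, and_false, if_false] at hsb
    omega
  have hexit := hU s h1.1
  rw [lastExit_reverse_cons_of_mem hmem, h1.2] at hexit
  have := pairCount_pos_of_lastExit hexit
  rw [pairCount_reverse] at this
  simp only [h1, and_self, if_true] at hsc
  omega

/-- The probability of a given order of the transitions in `N`. -/
noncomputable def orderProb (N : α → α → ℕ) : ℝ≥0∞ :=
  ∏ a, ((∏ b, (N a b).factorial : ℕ) : ℝ≥0∞) / ((∑ b, N a b).factorial : ℕ)

theorem prod_factorial_eq_mul_pred {f : α → ℕ} {c : α} (hc : 0 < f c) :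
    ∏ b, (f b).factorial = f c * ∏ b, (f b - if c = b then 1 else 0).factorial := by
  rw [← Finset.mul_prod_erase _ _ (Finset.mem_univ c),
    ← Finset.mul_prod_erase _ (fun b => (f b - if c = b then 1 else 0).factorial)
      (Finset.mem_univ c), ← mul_assoc]
  congr 1
  · simp [Nat.mul_factorial_pred hc.ne']
  · refine Finset.prod_congr rfl fun b hb => ?_
    simp [(Finset.ne_of_mem_erase hb).symm]

theorem sum_eq_sum_pred_add_one {f : α → ℕ} {c : α} (hc : 0 < f c) :
    ∑ b, f b = ∑ b, (f b - if c = b then 1 else 0) + 1 := by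
  rw [← Finset.add_sum_erase _ _ (Finset.mem_univ c),
    ← Finset.add_sum_erase _ (fun b => f b - if c = b then 1 else 0) (Finset.mem_univ c)]
  have : ∑ b ∈ Finset.univ.erase c, (f b - if c = b then 1 else 0) =
      ∑ b ∈ Finset.univ.erase c, f b :=
    Finset.sum_congr rfl fun b hb => by simp [(Finset.ne_of_mem_erase hb).symm]
  rw [this]
  simp only [if_true]
  omega

/-- Only row `s` changes: its factorials lose the factors `N s c` and `∑ b, N s b`, whose ratio is
the probability of drawing `c`. -/
theorem orderProb_removePair {c : α} (hc : 0 < N s c) :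
    orderProb N = (N s c : ℝ≥0∞) / (∑ b, N s b : ℕ) * orderProb (removePair N s c) := by
  let F : (α → α → ℕ) → α → ℝ≥0∞ := fun N a =>
    ((∏ b, (N a b).factorial : ℕ) : ℝ≥0∞) / ((∑ b, N a b).factorial : ℕ)
  change ∏ a, F N a = _ * ∏ a, F (removePair N s c) a
  rw [← Finset.mul_prod_erase _ (F N) (Finset.mem_univ s),
    ← Finset.mul_prod_erase _ (F (removePair N s c)) (Finset.mem_univ s), ← mul_assoc]
  congr 1
  · simp only [F, removePair, Prod.mk.injEq, true_and]
    rw [prod_factorial_eq_mul_pred hc, sum_eq_sum_pred_add_one hc, Nat.factorial_succ,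
      Nat.cast_mul, Nat.cast_mul, div_eq_mul_inv, div_eq_mul_inv, div_eq_mul_inv,
      ENNReal.mul_inv (Or.inl (Nat.cast_ne_zero.2 (Nat.succ_ne_zero _)))
        (Or.inl (ENNReal.natCast_ne_top _))]
    ring
  · refine Finset.prod_congr rfl fun a ha => ?_
    simp [F, removePair, (Finset.ne_of_mem_erase ha).symm]

end

theorem forwardWalk_succ_nil (ζ : List α) (m : ℕ) (N : α → α → ℕ) (s : α) :
    forwardWalk ζ (m + 1) N s [] = 0 := by
  rw [forwardWalk, Law.bind]
  refine ENNReal.tsum_eq_zero.2 fun c => ?_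
  rw [Law.bind_pure_notMem _ (by simp), mul_zero]

theorem forwardWalk_succ_cons (ζ : List α) (m : ℕ) (N : α → α → ℕ) (s c : α) (l : List α) :
    forwardWalk ζ (m + 1) N s (c :: l) =
      forwardStep ζ N s c * forwardWalk ζ m (removePair N s c) c l := by
  rw [forwardWalk, Law.bind, tsum_eq_single c]
  · rw [Law.bind_pure_inj _ List.cons_injective]
  · intro b hb
    rw [Law.bind_pure_notMem _ (by simp [hb]), mul_zero]

theorem tsum_forwardWalk_succ (ζ : List α) (m : ℕ) (N : α → α → ℕ) (s : α) :
    ∑' l, forwardWalk ζ (m + 1) N s l =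
      ∑ c, forwardStep ζ N s c * ∑' l, forwardWalk ζ m (removePair N s c) c l := by
  rw [forwardWalk, Law.tsum_bind, tsum_fintype]
  refine Finset.sum_congr rfl fun c _ => ?_
  rw [Law.tsum_bind]
  simp only [Law.tsum_pure, mul_one]

omit [Fintype α] in
-- Subtraction is truncated at zero, so using a reserved exit, whose row in `N` is empty, leaves `N`
-- as it is.
theorem removePair_eq_self {N : α → α → ℕ} {s c : α} (h : N s c = 0) : removePair N s c = N := by
  funext a b
  by_cases hab : s = a ∧ c = b
  · simp [removePair, ← hab.1, ← hab.2, h]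
  · simp [removePair, hab]

open Classical in
/-- The forward walk makes all transitions, and all the ways in which it can do so are equally
likely. -/
theorem forwardWalk_law {ζ : List α} {r : α} (m : ℕ) {N : α → α → ℕ} {U : Finset α} {s : α}
    (h : IsForwardState (lastExit ζ) r N U s m) :
    (∀ l, forwardWalk ζ m N s l = if IsCompletion (lastExit ζ) N U s l then orderProb N else 0) ∧
      ∑' l, forwardWalk ζ m N s l = 1 := by
  induction m generalizing N U s with
  | zero =>
    refine ⟨fun l => ?_, Law.tsum_pure _⟩
    have hrem : ∀ a b, remaining (lastExit ζ) N U a b = 0 := fun a b =>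
      Finset.sum_eq_zero_iff.1 (Finset.sum_eq_zero_iff.1 h.degrees.total a (Finset.mem_univ a)) b
        (Finset.mem_univ b)
    have hN : ∀ a b, N a b = 0 := fun a b => (Nat.add_eq_zero_iff.1 (hrem a b)).1
    have hU : ∀ v, v ∉ U := fun v hv => by
      obtain ⟨u, hu⟩ := h.exists_exit hv
      exact (remaining_pos hv hu).ne' (hrem v u)
    have hiff : IsCompletion (lastExit ζ) N U s l ↔ l = [] := by
      constructor
      · rintro ⟨hl, -⟩
        have := sum_pairCount (s :: l)
        simp only [hl, hrem, Finset.sum_const_zero] at this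
        simpa using this.symm
      · rintro rfl
        refine ⟨?_, fun v hv => absurd hv (hU v)⟩
        funext a b
        rw [pairCount_singleton, hrem]
    rw [forwardWalk, Law.pure_apply]
    simp [hiff, orderProb, hN]
  | succ m ih =>
    have hnil : ¬ IsCompletion (lastExit ζ) N U s [] := by
      rintro ⟨hl, -⟩
      have := h.degrees.total
      rw [← hl] at this
      simp [pairCount_singleton] at this
    by_cases hrow : 1 ≤ ∑ b, N s b
    · have hstep : forwardStep ζ N s = Law.draw (N s) := by simp only [forwardStep, hrow, if_true]
      constructor
      · rintro (_ | ⟨c, l⟩)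
        · rw [forwardWalk_succ_nil, if_neg hnil]
        · rw [forwardWalk_succ_cons, hstep]
          rcases Nat.eq_zero_or_pos (N s c) with hc | hc
          · rw [if_neg fun h => (pos_of_isCompletion h hrow).ne' hc]
            simp [Law.draw, hc]
          · rw [(ih (h.removePair hc)).1, orderProb_removePair hc]
            simp only [isCompletion_removePair h hc, Law.draw, mul_ite, mul_zero]
      · rw [tsum_forwardWalk_succ, hstep, ← Law.tsum_draw hrow, tsum_fintype]
        refine Finset.sum_congr rfl fun c _ => ?_
        rcases Nat.eq_zero_or_pos (N s c) with hc | hc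
        · simp [Law.draw, hc]
        · rw [(ih (h.removePair hc)).2, mul_one]
    · have h0 : ∑ b, N s b = 0 := by omega
      have hN : ∀ b, N s b = 0 := fun b => Finset.sum_eq_zero_iff.1 h0 b (Finset.mem_univ b)
      have hs := h.mem_of_row_eq_zero h0
      obtain ⟨c, hc⟩ := h.exists_exit hs
      have hstep : forwardStep ζ N s = Law.pure c := by
        simp only [forwardStep, hrow, if_false, hc]
      have h' := h.erase hs hc hN
      constructor
      · rintro (_ | ⟨d, l⟩)
        · rw [forwardWalk_succ_nil, if_neg hnil]
        · rw [forwardWalk_succ_cons, hstep, Law.pure_apply]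
          by_cases hd : d = c
          · rw [hd, if_pos rfl, one_mul, removePair_eq_self (hN c), (ih h').1]
            simp only [isCompletion_erase h hs hc hN]
          · rw [if_neg hd, zero_mul, if_neg]
            rintro ⟨hl, -⟩
            have := congrFun (congrFun hl s) d
            rw [pairCount_cons_cons] at this
            simp [remaining, hN, hc, Ne.symm hd] at this
      · rw [tsum_forwardWalk_succ, hstep, Finset.sum_eq_single c]
        · rw [removePair_eq_self (hN c), (ih h').2, Law.pure_apply, if_pos rfl, one_mul]
        · intro b _ hb
          rw [Law.pure_apply, if_neg hb, zero_mul]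
        · simp

end ForwardWalk

/-! ### Uniformity of the Euler algorithm. -/

section EulerLaw

variable {α : Type u} [Fintype α] [DecidableEq α]

/-- The transition counts `N` with the exits of `e` set aside. -/
def reserve (N : α → α → ℕ) (e : α → Option α) (a b : α) : ℕ :=
  N a b - if e a = some b then 1 else 0

/-- In row `a ≠ r` the tree contributes `N(a, t a)`, which completes the factorial of `N(a, t a) -
1`, while the row sum drops by one whatever `t a` is. The closing transition leaves `r` and so does
not enter. The point is that the right side is independent of `t`. -/
theorem treeWeight_mul_orderProb {ξ : List α} {r : α} (hr : ξ.getLast? = some r)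
    {t : α → Option α} (ht : IsExitTree ξ.toFinset r t)
    (hpos : ∀ v u, t v = some u → 0 < pairCount ξ v u) :
    (treeWeight (closedPairCount ξ) ξ.toFinset r t : ℝ≥0∞) *
        orderProb (reserve (pairCount ξ) t) =
      ∏ a, ((∏ b, (pairCount ξ a b).factorial : ℕ) : ℝ≥0∞) /
        ((∑ b, pairCount ξ a b - if a ∈ ξ.toFinset.erase r then 1 else 0).factorial : ℕ) := by
  have h1 : treeWeight (closedPairCount ξ) ξ.toFinset r t =
      ∏ a, if a ∈ ξ.toFinset.erase r then (t a).elim 0 (closedPairCount ξ a) else 1 := by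
    rw [Finset.prod_ite_mem, Finset.univ_inter, treeWeight]
  rw [h1, orderProb]
  push_cast
  rw [← Finset.prod_mul_distrib]
  refine Finset.prod_congr rfl fun a _ => ?_
  by_cases ha : a ∈ ξ.toFinset.erase r
  · have har := Finset.ne_of_mem_erase ha
    obtain ⟨u, -, hu⟩ := ht.exists_exit (List.mem_toFinset.2 (List.mem_of_getLast? hr))
      (Finset.mem_of_mem_erase ha) har
    have hc : closedPairCount ξ a u = pairCount ξ a u := by
      simp [closedPairCount, hr, Ne.symm har]
    simp only [ha, if_true, hu, Option.elim_some, hc, reserve, Option.some_inj]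
    have hp := prod_factorial_eq_mul_pred (hpos a u hu)
    have hs := sum_eq_sum_pred_add_one (hpos a u hu)
    rw [← Nat.cast_prod, ← Nat.cast_prod, hp, hs, Nat.add_sub_cancel, Nat.cast_mul, mul_div_assoc]
  · have hta : t a = none := by
      by_cases har : a = r
      · rw [har, ht.root]
      · exact ht.off a fun h => ha (Finset.mem_erase.2 ⟨har, h⟩)
    simp only [ha, if_false, reserve, hta, Nat.sub_zero, one_mul, reduceCtorEq]

omit [Fintype α] in
theorem reservedPairCount_eq (ξ ζ : List α) :
    reservedPairCount ξ ζ = reserve (pairCount ξ) (lastExit ζ) := rfl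

/-- Setting exits aside loses nothing to truncation: an exit from `a ≠ r` is a genuine transition of
`ξ`, as the closing one starts at `r`. -/
theorem remaining_reserve {ξ ζ : List α} {r : α} (hr : ξ.getLast? = some r)
    (h : IsBackwardWalk ξ r ζ) :
    remaining (lastExit ζ) (reserve (pairCount ξ) (lastExit ζ)) (ξ.toFinset.erase r) =
      pairCount ξ := by
  funext a b
  unfold remaining reserve
  by_cases hab : lastExit ζ a = some b
  · have hp := pairCount_pos_of_lastExit hab
    have hc := h.step _ _ hp
    have har : a ≠ r := by
      rintro rfl
      simp [lastExit_head h.head] at hab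
    have ha : a ∈ ξ.toFinset.erase r :=
      Finset.mem_erase.2 ⟨har, List.mem_toFinset.2 (h.mem a (mem_right_of_pairCount_pos hp))⟩
    simp only [closedPairCount, hr, Option.some_inj, har.symm, false_and, if_false, zero_add] at hc
    simp only [hab, ha, and_self, if_true]
    omega
  · simp [hab]

theorem isForwardState_reserve {a r : α} {ξ₀ ζ : List α}
    (hr : (a :: ξ₀).getLast? = some r) (h : IsBackwardWalk (a :: ξ₀) r ζ)
    (hcov : ∀ b ∈ a :: ξ₀, b ∈ ζ) :
    IsForwardState (lastExit ζ) r (reserve (pairCount (a :: ξ₀)) (lastExit ζ))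
      ((a :: ξ₀).toFinset.erase r) a ((a :: ξ₀).length - 1) where
  degrees := by
    rw [remaining_reserve hr h]
    refine ⟨fun v => ?_, sum_pairCount _⟩
    have h1 := sum_pairCount_right (a :: ξ₀) v
    have h2 := sum_pairCount_left (a :: ξ₀) v
    rw [hr] at h1
    simp only [List.head?_cons, Option.some_inj, eq_comm (b := v)] at h1 h2
    rw [h1, h2]
  reach v hv := (isExitTree_lastExit h.head fun a => ⟨h.mem a, hcov a⟩).reach v
    (Finset.mem_of_mem_erase hv)
  root := Finset.notMem_erase r _
  exhausted v hv hvr b := by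
    have : pairCount (a :: ξ₀) v b = 0 := by
      by_contra h0
      exact hv (Finset.mem_erase.2 ⟨hvr, List.mem_toFinset.2
        (mem_left_of_pairCount_pos (Nat.pos_of_ne_zero h0))⟩)
    rw [reserve, this, Nat.zero_sub]

theorem tsum_eulerAlgorithm {ξ : List α} (hξ : ξ ≠ []) : ∑' ξ', eulerAlgorithm ξ ξ' = 1 := by
  obtain ⟨a, ξ₀, rfl⟩ := List.exists_cons_of_ne_nil hξ
  have hr := List.getLast?_eq_some_getLast hξ
  rw [eulerAlgorithm, Law.tsum_bind, ← tsum_backwardWalk hξ]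
  refine tsum_congr fun ζ => ?_
  by_cases h0 : backwardWalk (a :: ξ₀) ζ = 0
  · rw [h0, zero_mul]
  · obtain ⟨h, hcov⟩ := backwardWalk_support hr h0
    simp only [Law.tsum_bind, Law.tsum_pure, mul_one, reservedPairCount_eq]
    rw [(forwardWalk_law _ (isForwardState_reserve hr h hcov)).2, mul_one]

open Classical in
/-- The outcome of the Euler algorithm is uniformly distributed on the sequences with the first
value and the transition counts of `ξ`. -/
theorem exists_eulerAlgorithm_eq {ξ : List α} (hξ : ξ ≠ []) : ∃ c : ℝ≥0∞, ∀ ξ',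
    eulerAlgorithm ξ ξ' = if ξ'.head? = ξ.head? ∧ pairCount ξ' = pairCount ξ then c else 0 := by
  obtain ⟨a, ξ₀, rfl⟩ := List.exists_cons_of_ne_nil hξ
  obtain ⟨r, hr⟩ : ∃ r, (a :: ξ₀).getLast? = some r := ⟨_, List.getLast?_eq_some_getLast hξ⟩
  set ξ := a :: ξ₀ with hξ'
  have htree : ∀ ξ', ξ'.head? = ξ.head? → pairCount ξ' = pairCount ξ →
      IsExitTree ξ.toFinset r (lastExit ξ'.reverse) ∧
        ∀ v u, lastExit ξ'.reverse v = some u → 0 < pairCount ξ v u := by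
    intro ξ' hh hp
    refine ⟨isExitTree_lastExit ?_ fun a => ?_, fun v u h => ?_⟩
    · rw [List.head?_reverse, getLast?_eq_of_pairCount_eq hp hh, hr]
    · rw [List.mem_reverse, (perm_of_pairCount_eq hp hh).mem_iff]
    · have := pairCount_pos_of_lastExit h
      rwa [pairCount_reverse, hp] at this
  have hZ : (totalWeight ξ r : ℝ≥0∞) ≠ 0 := by
    obtain ⟨ht, hpos⟩ := htree ξ rfl rfl
    rw [Nat.cast_ne_zero]
    refine ((Nat.pos_of_ne_zero ?_).trans_le (Finset.single_le_sum (fun _ _ => zero_le)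
      (mem_exitTrees.2 ht))).ne'
    rw [treeWeight, Finset.prod_ne_zero_iff]
    intro v hv
    obtain ⟨u, -, hu⟩ := ht.exists_exit (List.mem_toFinset.2 (List.mem_of_getLast? hr))
      (Finset.mem_of_mem_erase hv) (Finset.ne_of_mem_erase hv)
    have := hpos v u hu
    rw [hu, Option.elim_some, closedPairCount]
    omega
  -- Tree weight times `orderProb`, in its tree-free form, divided by the total weight of the trees.
  refine ⟨(∏ a, ((∏ b, (pairCount ξ a b).factorial : ℕ) : ℝ≥0∞) /
    ((∑ b, pairCount ξ a b - if a ∈ ξ.toFinset.erase r then 1 else 0).factorial : ℕ)) /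
      totalWeight ξ r, ?_⟩
  have heuler : ∀ ξ', eulerAlgorithm ξ ξ' = ∑' ζ, backwardWalk ξ ζ *
      Law.bind (forwardWalk ζ (ξ.length - 1) (reserve (pairCount ξ) (lastExit ζ)) a)
        (fun l => Law.pure (a :: l)) ξ' := fun _ => rfl
  intro ξ'
  rw [heuler]
  rcases ξ' with _ | ⟨b, l⟩
  · rw [if_neg (by simp [hξ'])]
    refine ENNReal.tsum_eq_zero.2 fun ζ => ?_
    rw [Law.bind_pure_notMem _ (by simp), mul_zero]
  by_cases hb : b = a
  swap
  · rw [if_neg (by simp [hξ', hb])]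
    refine ENNReal.tsum_eq_zero.2 fun ζ => ?_
    rw [Law.bind_pure_notMem _ (by simp [Ne.symm hb]), mul_zero]
  subst hb
  simp only [Law.bind_pure_inj _ List.cons_injective]
  have hterm : ∀ ζ, backwardWalk ξ ζ *
      forwardWalk ζ (ξ.length - 1) (reserve (pairCount ξ) (lastExit ζ)) b l =
      backwardWalk ξ ζ * if IsCompletion (lastExit ζ) (reserve (pairCount ξ) (lastExit ζ))
        (ξ.toFinset.erase r) b l then orderProb (reserve (pairCount ξ) (lastExit ζ)) else 0 := by
    intro ζ
    by_cases h0 : backwardWalk ξ ζ = 0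
    · rw [h0, zero_mul, zero_mul]
    · obtain ⟨h, hcov⟩ := backwardWalk_support hr h0
      rw [(forwardWalk_law _ (isForwardState_reserve hr h hcov)).1]
  rw [tsum_congr hterm]
  by_cases hp : pairCount (b :: l) = pairCount ξ
  · obtain ⟨ht, hpos⟩ := htree (b :: l) (by simp [hξ']) hp
    rw [if_pos ⟨by simp [hξ'], hp⟩, ENNReal.eq_div_iff hZ (ENNReal.natCast_ne_top _),
      ← treeWeight_mul_orderProb hr ht hpos, ← tsum_backwardWalk_lastExit hr ht,
      ← ENNReal.tsum_mul_left, ← ENNReal.tsum_mul_right]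
    refine tsum_congr fun ζ => ?_
    by_cases h0 : backwardWalk ξ ζ = 0
    · simp [h0]
    · obtain ⟨h, hcov⟩ := backwardWalk_support hr h0
      have ht' := isExitTree_lastExit h.head fun a => ⟨h.mem a, hcov a⟩
      -- An admissible sequence arises only from those backward walks whose tree is its own tree of
      -- last exits.
      have hiff : IsCompletion (lastExit ζ) (reserve (pairCount ξ) (lastExit ζ))
          (ξ.toFinset.erase r) b l ↔ lastExit ζ = lastExit (b :: l).reverse := by
        rw [IsCompletion, remaining_reserve hr h]
        constructor
        · rintro ⟨-, hU⟩
          funext v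
          by_cases hvr : v = r
          · rw [hvr, ht.root, ht'.root]
          · by_cases hv : v ∈ ξ.toFinset
            · exact (hU v (Finset.mem_erase.2 ⟨hvr, hv⟩)).symm
            · rw [ht.off v hv, ht'.off v hv]
        · exact fun h => ⟨hp, fun v _ => by rw [h]⟩
      by_cases hζ : lastExit ζ = lastExit (b :: l).reverse
      · rw [if_pos (hiff.2 hζ), if_pos hζ, hζ]
        ring
      · rw [if_neg fun h => hζ (hiff.1 h), if_neg hζ]
        simp
  · rw [if_neg fun h => hp h.2]
    refine ENNReal.tsum_eq_zero.2 fun ζ => ?_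
    by_cases h0 : backwardWalk ξ ζ = 0
    · rw [h0, zero_mul]
    · obtain ⟨h, hcov⟩ := backwardWalk_support hr h0
      rw [if_neg, mul_zero]
      rintro ⟨hl, -⟩
      rw [remaining_reserve hr h] at hl
      exact hp hl

end EulerLaw

/-- Repeating `μ` until its result satisfies `P`. -/
theorem Law.loop_until_mul {β : Type v} {μ : Law β} (hμ : ∑' b, μ b = 1) (P : β → Prop)
    [DecidablePred P] (b : β) :
    Law.loop (fun _ : Unit => Law.bind μ fun a =>
      if P a then Law.pure (Sum.inr a) else Law.pure (Sum.inl ())) () b *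
      (∑' a, if P a then μ a else 0) = if P b then μ b else 0 := by
  classical
  set body : Unit → Law (Unit ⊕ β) := fun _ => Law.bind μ fun a =>
    if P a then Law.pure (Sum.inr a) else Law.pure (Sum.inl ()) with hbody
  have hsum : ∀ F : Unit ⊕ β → ℝ≥0∞, ∑' r, body () r * F r =
      ∑' a, μ a * if P a then F (Sum.inr a) else F (Sum.inl ()) := by
    intro F
    rw [hbody, Law.tsum_bind_mul]
    refine tsum_congr fun a => ?_
    split_ifs <;> rw [Law.tsum_pure_mul]
  set L := Law.loop body () b with hL
  have hind : ∀ x, ∑' b', Law.loop body x b' * (if b' = b then 1 else 0) = Law.loop body x b := by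
    intro x
    rw [tsum_eq_single b]
    · simp
    · intro b' hb'
      simp [hb']
  have hL1 : L ≤ 1 := by
    have := Law.tsum_loop_mul_le (body := body) (Inv := fun _ => True) (fun _ _ _ _ => trivial)
      (G := fun _ => 1) (h := fun b' => if b' = b then 1 else 0) (fun x _ => by
        rw [hsum]
        refine (ENNReal.tsum_le_tsum fun a => mul_le_of_le_one_right' ?_).trans hμ.le
        simp only [Sum.elim_inr, Sum.elim_inl]
        split_ifs <;> simp) (x := ()) trivial
    rwa [hind] at this
  -- Either the first trial is accepted or the loop restarts. Since acceptance and rejection have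
  -- total mass one, cancelling the finite rejection term gives the claim without dividing by the
  -- acceptance probability.
  have hfix : L = (if P b then μ b else 0) + (∑' a, if P a then 0 else μ a) * L := by
    have := Law.tsum_loop_mul_eq body () fun b' => if b' = b then 1 else 0
    rw [hind, hsum] at this
    simp only [Sum.elim_inr, Sum.elim_inl, hind] at this
    rw [← hL] at this
    have h1 : (if P b then μ b else 0) = ∑' a, if a = b then (if P a then μ a else 0) else 0 := by
      rw [tsum_ite_eq]
    rw [h1, ← ENNReal.tsum_mul_right, ← ENNReal.tsum_add]
    refine this.trans (tsum_congr fun a => ?_)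
    split_ifs <;> simp
  have hpq : (∑' a, if P a then μ a else 0) + (∑' a, if P a then 0 else μ a) = 1 := by
    rw [← ENNReal.tsum_add, ← hμ]
    refine tsum_congr fun a => ?_
    split_ifs <;> simp
  set p := ∑' a, if P a then μ a else 0
  set q := ∑' a, if P a then 0 else μ a
  have hq1 : q ≤ 1 := hpq ▸ le_add_self
  have hqL : q * L ≠ ∞ := ENNReal.mul_ne_top (ne_top_of_le_ne_top ENNReal.one_ne_top hq1)
    (ne_top_of_le_ne_top ENNReal.one_ne_top hL1)
  refine (ENNReal.add_left_inj hqL).1 ?_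
  rw [← hfix, mul_comm L p, ← add_mul, hpq, one_mul]

/-! ### Rows of a configuration, singly and joined, as sequences with separator `0`. -/

section Rows

variable {𝒮 : Type u} {n T : ℕ}

theorem length_toSeq (x : Fin T → 𝒮) : (toSeq x).length = T := by simp [toSeq]

theorem none_notMem_toSeq (x : Fin T → 𝒮) : none ∉ toSeq x := by simp [toSeq, List.mem_ofFn]

theorem toSeq_injective : Function.Injective (toSeq : (Fin T → 𝒮) → List (Option 𝒮)) := by
  intro x y h
  funext t
  have := congrFun (List.ofFn_injective h) t
  simpa using this

theorem exists_toSeq_eq {l : List (Option 𝒮)} (hl : l.length = T) (hn : none ∉ l) :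
    ∃ x : Fin T → 𝒮, toSeq x = l := by
  subst hl
  have h : ∀ t : Fin l.length, ∃ a, some a = l[t] := by
    intro t
    cases h : l[t] with
    | none => exact absurd (h ▸ List.getElem_mem _) hn
    | some a => exact ⟨a, rfl⟩
  choose x hx using h
  refine ⟨x, ?_⟩
  simp only [toSeq, hx]
  exact List.ofFn_getElem

theorem head?_toSeq (hT : 1 ≤ T) (x : Fin T → 𝒮) :
    (toSeq x).head? = some (some (x ⟨0, hT⟩)) := by
  rw [List.head?_eq_getElem?, toSeq, List.getElem?_ofFn, dif_pos]

theorem getLast?_toSeq (hT : 1 ≤ T) (x : Fin T → 𝒮) :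
    (toSeq x).getLast? = some (some (x ⟨T - 1, by omega⟩)) := by
  rw [List.getLast?_eq_getElem?, length_toSeq, toSeq, List.getElem?_ofFn, dif_pos]

/-- The rows `x` and `y`, each followed by `0`. -/
def joinRows (x y : Fin T → 𝒮) : List (Option 𝒮) := toSeq x ++ [none] ++ toSeq y ++ [none]

theorem joinedSeq_eq (I : Fin n × Fin n) (S : Config n T 𝒮) :
    joinedSeq I S = joinRows (S I.1) (S I.2) := rfl

theorem take_joinRows (x y : Fin T → 𝒮) : (joinRows x y).take T = toSeq x := by
  rw [joinRows, List.append_assoc, List.append_assoc,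
    List.take_append_of_le_length (length_toSeq x).ge, List.take_of_length_le (length_toSeq x).le]

theorem drop_joinRows (x y : Fin T → 𝒮) :
    (joinRows x y).drop (T + 1) = toSeq y ++ [none] := by
  rw [joinRows, List.append_assoc]
  exact List.drop_left' (by simp [length_toSeq])

theorem take_drop_joinRows (x y : Fin T → 𝒮) :
    ((joinRows x y).drop (T + 1)).take T = toSeq y := by
  rw [drop_joinRows, List.take_append_of_le_length (length_toSeq y).ge,
    List.take_of_length_le (length_toSeq y).le]

theorem getElem?_joinRows (x y : Fin T → 𝒮) : (joinRows x y)[T]? = some none := by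
  rw [joinRows, List.append_assoc, List.append_assoc,
    List.getElem?_append_right (length_toSeq x).le, length_toSeq]
  simp

theorem joinRows_injective :
    Function.Injective fun p : (Fin T → 𝒮) × (Fin T → 𝒮) => joinRows p.1 p.2 := by
  rintro ⟨x, y⟩ ⟨x', y'⟩ h
  have h1 := congrArg (List.take T) h
  have h2 := congrArg (fun l => (List.drop (T + 1) l).take T) h
  simp only [take_joinRows, take_drop_joinRows] at h1 h2
  rw [toSeq_injective h1, toSeq_injective h2]

variable [Fintype 𝒮] [DecidableEq 𝒮]

omit [Fintype 𝒮] in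
theorem pairCount_toSeq (x : Fin T → 𝒮) (a b : 𝒮) :
    pairCount (toSeq x) (some a) (some b) = transitionCount x a b := by
  induction T with
  | zero => simp [toSeq, pairCount_nil, transitionCount]
  | succ T ih =>
    cases T with
    | zero =>
      rw [toSeq, List.ofFn_succ, List.ofFn_zero, pairCount_singleton, transitionCount, eq_comm,
        Finset.card_eq_zero]
      exact Finset.filter_eq_empty_iff.2 fun t _ ⟨h, _⟩ => by omega
    | succ T =>
      have h1 : pairCount (toSeq x) (some a) (some b) =
          (if x 0 = a ∧ x 1 = b then 1 else 0) +
            pairCount (toSeq fun t => x t.succ) (some a) (some b) := by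
        simp only [toSeq, List.ofFn_succ (n := T + 1), List.ofFn_succ (n := T)]
        rw [pairCount_cons_cons]
        simp
      rw [h1, ih]
      unfold transitionCount
      rw [Fin.card_filter_univ_succ (n := T + 1)]
      have h2 : (∃ h : ((0 : Fin (T + 1 + 1)) : ℕ) + 1 < T + 1 + 1,
          x 0 = a ∧ x ⟨((0 : Fin (T + 1 + 1)) : ℕ) + 1, h⟩ = b) ↔ x 0 = a ∧ x 1 = b := by
        constructor
        · rintro ⟨h, h'⟩
          exact h'
        · exact fun h => ⟨by simp, h⟩
      simp only [h2]
      have h3 : ∀ t : Fin (T + 1), (∃ h : ((t.succ : Fin (T + 1 + 1)) : ℕ) + 1 < T + 1 + 1,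
          x t.succ = a ∧ x ⟨(t.succ : ℕ) + 1, h⟩ = b) ↔
          ∃ h : (t : ℕ) + 1 < T + 1, x t.succ = a ∧ x (Fin.succ ⟨(t : ℕ) + 1, h⟩) = b := by
        intro t
        constructor
        · rintro ⟨h, h'⟩
          exact ⟨by simpa using h, h'⟩
        · rintro ⟨h, h'⟩
          exact ⟨by simpa using h, h'⟩
      simp only [h3]
      split_ifs <;> omega

theorem pairCount_toSeq_none_left (x : Fin T → 𝒮) (o : Option 𝒮) :
    pairCount (toSeq x) none o = 0 := by
  by_contra h
  exact none_notMem_toSeq x (mem_left_of_pairCount_pos (Nat.pos_of_ne_zero h))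

theorem pairCount_toSeq_none_right (x : Fin T → 𝒮) (o : Option 𝒮) :
    pairCount (toSeq x) o none = 0 := by
  by_contra h
  exact none_notMem_toSeq x (mem_right_of_pairCount_pos (Nat.pos_of_ne_zero h))

theorem sum_transitionCount (hT : 1 ≤ T) (x : Fin T → 𝒮) (a : 𝒮) :
    ∑ b, transitionCount x a b + (if x ⟨T - 1, by omega⟩ = a then 1 else 0) =
      ∑ b, transitionCount x b a + if x ⟨0, hT⟩ = a then 1 else 0 := by
  have h1 := sum_pairCount_right (toSeq x) (some a)
  have h2 := sum_pairCount_left (toSeq x) (some a)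
  rw [Fintype.sum_option, pairCount_toSeq_none_right, getLast?_toSeq hT, zero_add] at h1
  rw [Fintype.sum_option, pairCount_toSeq_none_left, head?_toSeq hT, zero_add] at h2
  simp only [pairCount_toSeq, Option.some_inj] at h1 h2
  rw [h1, h2]

/-- `y` has the first value and the transition counts of `x`. -/
theorem toSeq_equivalent_iff (hT : 1 ≤ T) (x y : Fin T → 𝒮) :
    ((toSeq y).head? = (toSeq x).head? ∧ pairCount (toSeq y) = pairCount (toSeq x)) ↔
      y ⟨0, hT⟩ = x ⟨0, hT⟩ ∧ ∀ s s', transitionCount y s s' = transitionCount x s s' := by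
  rw [head?_toSeq hT, head?_toSeq hT, Option.some_inj, Option.some_inj]
  refine and_congr_right fun _ => ⟨fun h s s' => ?_, fun h => ?_⟩
  · rw [← pairCount_toSeq, h, pairCount_toSeq]
  · funext o o'
    cases o with
    | none => rw [pairCount_toSeq_none_left, pairCount_toSeq_none_left]
    | some s =>
      cases o' with
      | none => rw [pairCount_toSeq_none_right, pairCount_toSeq_none_right]
      | some s' => rw [pairCount_toSeq, pairCount_toSeq, h]

omit [Fintype 𝒮] [DecidableEq 𝒮] in
theorem toSeq_ne_nil (hT : 1 ≤ T) (x : Fin T → 𝒮) : toSeq x ≠ [] := by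
  intro h
  have := length_toSeq x
  rw [h, List.length_nil] at this
  omega

omit [Fintype 𝒮] [DecidableEq 𝒮] in
theorem joinRows_ne_nil (x y : Fin T → 𝒮) : joinRows x y ≠ [] := by simp [joinRows]

/-- Every possible outcome is a permutation of `toSeq x`, so it has length `T`, avoids `0`, and is
itself a row. -/
theorem sum_eulerAlgorithm_toSeq (hT : 1 ≤ T) (x : Fin T → 𝒮) :
    ∑ y : Fin T → 𝒮, eulerAlgorithm (toSeq x) (toSeq y) = 1 := by
  classical
  rw [← tsum_fintype (L := .unconditional _), ← tsum_eulerAlgorithm (toSeq_ne_nil hT x)]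
  refine toSeq_injective.tsum_eq fun ξ hξ => ?_
  obtain ⟨c, hc⟩ := exists_eulerAlgorithm_eq (toSeq_ne_nil hT x)
  rw [Function.mem_support, hc] at hξ
  obtain ⟨hh, hp⟩ : ξ.head? = (toSeq x).head? ∧ pairCount ξ = pairCount (toSeq x) := by
    by_contra h
    simp [h] at hξ
  have hperm := perm_of_pairCount_eq hp hh
  exact exists_toSeq_eq (hperm.length_eq.trans (length_toSeq x))
    (fun h => none_notMem_toSeq x (hperm.mem_iff.1 h))

omit [Fintype 𝒮] in
theorem pairCount_joinRows (hT : 1 ≤ T) (x y : Fin T → 𝒮) (o o' : Option 𝒮) :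
    pairCount (joinRows x y) o o' = pairCount (toSeq x) o o' + pairCount (toSeq y) o o' +
      (if some (x ⟨T - 1, by omega⟩) = o ∧ none = o' then 1 else 0) +
      (if some (y ⟨T - 1, by omega⟩) = o ∧ none = o' then 1 else 0) +
      if none = o ∧ some (y ⟨0, hT⟩) = o' then 1 else 0 := by
  rw [joinRows, pairCount_concat, pairCount_append, pairCount_concat]
  simp only [List.getLast?_append, getLast?_toSeq hT, head?_toSeq hT, List.getLast?_singleton,
    Option.some_or, Option.some_inj]
  omega

/-- The joined rows `x'`, `y'` have the first value and the transition counts of the joined rows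
`x`, `y` if the rows have the same first values and the same total transition counts. -/
theorem joinRows_equivalent_iff (hT : 1 ≤ T) (x y x' y' : Fin T → 𝒮) :
    ((joinRows x' y').head? = (joinRows x y).head? ∧
        pairCount (joinRows x' y') = pairCount (joinRows x y)) ↔
      (x' ⟨0, hT⟩ = x ⟨0, hT⟩ ∧ y' ⟨0, hT⟩ = y ⟨0, hT⟩) ∧ ∀ s s',
        transitionCount x' s s' + transitionCount y' s s' =
          transitionCount x s s' + transitionCount y s s' := by
  have hhead : ∀ x y : Fin T → 𝒮, (joinRows x y).head? = some (some (x ⟨0, hT⟩)) := by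
    intro x y
    simp [joinRows, List.head?_append, head?_toSeq hT]
  rw [hhead, hhead, Option.some_inj, Option.some_inj, and_assoc]
  refine and_congr_right fun hx => ?_
  constructor
  · intro h
    -- The first `0` is followed by the start of the second row, and the other `0` has no successor.
    have hy : y' ⟨0, hT⟩ = y ⟨0, hT⟩ := by
      have := congrFun (congrFun h none) (some (y ⟨0, hT⟩))
      rw [pairCount_joinRows hT, pairCount_joinRows hT] at this
      simpa [pairCount_toSeq_none_left] using this
    refine ⟨hy, fun s s' => ?_⟩
    have := congrFun (congrFun h (some s)) (some s')
    rw [pairCount_joinRows hT, pairCount_joinRows hT] at this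
    simpa [pairCount_toSeq] using this
  · rintro ⟨hy, h⟩
    funext o o'
    rw [pairCount_joinRows hT, pairCount_joinRows hT]
    cases o with
    | none => simp [pairCount_toSeq_none_left, hy]
    | some s =>
      cases o' with
      | some s' => simpa [pairCount_toSeq] using h s s'
      | none =>
        simp only [pairCount_toSeq_none_right, Option.some_inj, and_true, reduceCtorEq, false_and,
          if_false]
        -- Transitions into `0` record how many rows end at `s`. Starts and total counts determine
        -- this number, although the two rows may exchange their ends.
        have h1 := sum_transitionCount hT x s
        have h2 := sum_transitionCount hT y s
        have h3 := sum_transitionCount hT x' s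
        have h4 := sum_transitionCount hT y' s
        have h5 : ∑ b, transitionCount x' s b + ∑ b, transitionCount y' s b =
            ∑ b, transitionCount x s b + ∑ b, transitionCount y s b := by
          simp only [← Finset.sum_add_distrib, h]
        have h6 : ∑ b, transitionCount x' b s + ∑ b, transitionCount y' b s =
            ∑ b, transitionCount x b s + ∑ b, transitionCount y b s := by
          simp only [← Finset.sum_add_distrib, h]
        rw [hx] at h3
        rw [hy] at h4
        omega

/-- There are exactly two zeros: one at index `T`, counted from zero, by acceptance, and one at the
end, which the counts prescribe. The two blocks of length `T` between them are therefore rows. -/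
theorem exists_joinRows_eq {x y : Fin T → 𝒮} {ξ : List (Option 𝒮)}
    (hh : ξ.head? = (joinRows x y).head?) (hp : pairCount ξ = pairCount (joinRows x y))
    (hT : ξ[T]? = some none) : ∃ x' y' : Fin T → 𝒮, joinRows x' y' = ξ := by
  have hperm := perm_of_pairCount_eq hp hh
  have hlast := getLast?_eq_of_pairCount_eq hp hh
  have hlen : ξ.length = T + 1 + (T + 1) := by
    rw [hperm.length_eq]
    simp [joinRows, length_toSeq]
    omega
  have hcount : ξ.count none = 2 := by
    rw [hperm.count_eq]
    simp [joinRows, List.count_eq_zero_of_not_mem (none_notMem_toSeq _)]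
  obtain ⟨hlt, hTe⟩ := List.getElem?_eq_some_iff.1 hT
  have hξ : ξ = ξ.take T ++ none :: ξ.drop (T + 1) := by
    rw [← hTe, List.cons_getElem_drop_succ, List.take_append_drop]
  obtain ⟨q, z, hq⟩ : ∃ q z, ξ.drop (T + 1) = q ++ [z] := by
    rcases (ξ.drop (T + 1)).eq_nil_or_concat with h | ⟨q, z, h⟩
    · have := congrArg List.length h
      simp [hlen] at this
    · exact ⟨q, z, by simpa using h⟩
  have hqlen : q.length = T := by
    have := congrArg List.length hq
    simp [hlen] at this
    omega
  rw [hq] at hξ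
  obtain rfl : z = none := by
    rw [hξ] at hlast
    simpa [joinRows, List.getLast?_append, List.getLast?_cons] using hlast
  rw [hξ] at hcount
  simp only [List.count_append, List.count_cons, beq_self_eq_true, if_true, List.count_nil] at hcount
  obtain ⟨x', hx'⟩ := exists_toSeq_eq (T := T) (l := ξ.take T) (by simp [hlen]; omega)
    (List.count_eq_zero.1 (by omega))
  obtain ⟨y', hy'⟩ := exists_toSeq_eq (T := T) hqlen (List.count_eq_zero.1 (by omega))
  refine ⟨x', y', ?_⟩
  rw [hξ, joinRows, hx', hy']
  simp

end Rows

/-! ### The law of the modified Euler algorithm. -/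

section Outcome

variable {𝒮 : Type u} [Fintype 𝒮] [DecidableEq 𝒮] {n T : ℕ}

theorem self_mem_RS (I : Fin n × Fin n) (S : Config n T 𝒮) : S ∈ RS I S := by simp [RS]

theorem mem_RS_iff_of_eq (hT : 1 ≤ T) {I : Fin n × Fin n} (hI : I.1 = I.2) (S S' : Config n T 𝒮) :
    S' ∈ RS I S ↔ ∀ i, (toSeq (S' i)).head? = (toSeq (S i)).head? ∧
      pairCount (toSeq (S' i)) = pairCount (toSeq (S i)) := by
  simp only [toSeq_equivalent_iff hT, RS, Finset.mem_filter, Finset.mem_univ, true_and, ← hI,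
    Finset.pair_eq_singleton, Finset.mem_singleton, Finset.sum_singleton]
  constructor
  · rintro ⟨h1, h2, h3⟩ i
    refine ⟨h1 i _ rfl, fun s s' => ?_⟩
    by_cases hi : i = I.1
    · rw [hi, h3]
    · exact h2 s s' i hi
  · intro h
    refine ⟨fun i t ht => ?_, fun s s' i _ => (h i).2 s s', fun s s' => (h _).2 s s'⟩
    obtain rfl : t = ⟨0, hT⟩ := Fin.ext ht
    exact (h i).1

theorem mem_RS_iff_of_ne (hT : 1 ≤ T) {I : Fin n × Fin n} (hI : I.1 ≠ I.2) (S S' : Config n T 𝒮) :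
    S' ∈ RS I S ↔
      ((joinRows (S' I.1) (S' I.2)).head? = (joinRows (S I.1) (S I.2)).head? ∧
        pairCount (joinRows (S' I.1) (S' I.2)) = pairCount (joinRows (S I.1) (S I.2))) ∧
      ∀ i, i ≠ I.1 → i ≠ I.2 → (toSeq (S' i)).head? = (toSeq (S i)).head? ∧
        pairCount (toSeq (S' i)) = pairCount (toSeq (S i)) := by
  simp only [toSeq_equivalent_iff hT, joinRows_equivalent_iff hT, RS, Finset.mem_filter,
    Finset.mem_univ, true_and, Finset.sum_pair hI, Finset.mem_insert, Finset.mem_singleton, not_or]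
  constructor
  · rintro ⟨h1, h2, h3⟩
    exact ⟨⟨⟨h1 _ _ rfl, h1 _ _ rfl⟩, h3⟩,
      fun i hi1 hi2 => ⟨h1 i _ rfl, fun s s' => h2 s s' i ⟨hi1, hi2⟩⟩⟩
  · rintro ⟨⟨⟨h1, h2⟩, h3⟩, h4⟩
    refine ⟨fun i t ht => ?_, fun s s' i hi => (h4 i hi.1 hi.2).2 s s', h3⟩
    obtain rfl : t = ⟨0, hT⟩ := Fin.ext ht
    by_cases hi1 : i = I.1
    · rw [hi1, h1]
    by_cases hi2 : i = I.2
    · rw [hi2, h2]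
    exact (h4 i hi1 hi2).1

theorem sum_prod_eq_one {β : Type*} [Fintype β] {f : Fin n → β → ℝ≥0∞}
    (hf : ∀ i, ∑ b, f i b = 1) : ∑ x : Fin n → β, ∏ i, f i (x i) = 1 := by
  classical
  have h := Finset.prod_univ_sum (fun _ : Fin n => (Finset.univ : Finset β)) f
  rw [Fintype.piFinset_univ] at h
  rw [← h]
  exact Finset.prod_eq_one fun i _ => hf i

theorem eq_inv_card_of_sum_eq_one {β : Type*} [Fintype β] [DecidableEq β] {f : β → ℝ≥0∞} {A : Finset β} {c : ℝ≥0∞}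
    (hf : ∀ b, f b = if b ∈ A then c else 0) (hsum : ∑ b, f b = 1) : c = (A.card : ℝ≥0∞)⁻¹ := by
  refine ENNReal.eq_inv_of_mul_eq_one_left ?_
  rw [← hsum, Finset.sum_congr rfl fun b _ => hf b, Finset.sum_ite_mem, Finset.univ_inter,
    Finset.sum_const, nsmul_eq_mul, mul_comm]

open Classical in
/-- The accepted outcome of the Euler algorithm on the joined rows is uniformly distributed. -/
theorem exists_joinedDraw_eq (I : Fin n × Fin n) (S : Config n T 𝒮) :
    (∃ c : ℝ≥0∞, ∀ ξ, joinedDraw I S ξ =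
      if (ξ.head? = (joinRows (S I.1) (S I.2)).head? ∧
        pairCount ξ = pairCount (joinRows (S I.1) (S I.2))) ∧ ξ[T]? = some none then c else 0) ∧
    ∑' ξ, joinedDraw I S ξ = 1 := by
  set ξ₀ := joinRows (S I.1) (S I.2)
  obtain ⟨c, hc⟩ := exists_eulerAlgorithm_eq (ξ := ξ₀) (joinRows_ne_nil _ _)
  have hmass := tsum_eulerAlgorithm (ξ := ξ₀) (joinRows_ne_nil _ _)
  have hloop := Law.loop_until_mul hmass fun ξ => ξ[T]? = some none
  set p := ∑' ξ, if ξ[T]? = some none then eulerAlgorithm ξ₀ ξ else 0 with hp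
  have hdraw : ∀ ξ, joinedDraw I S ξ * p =
      if ξ[T]? = some none then eulerAlgorithm ξ₀ ξ else 0 := by
    intro ξ
    rw [hp, ← hloop ξ, joinedDraw, joinedSeq_eq]
  have hc0 : c ≠ 0 := by
    rintro rfl
    simp [hc] at hmass
  -- The input sequence is itself an acceptable outcome of positive probability.
  have hp0 : p ≠ 0 := by
    intro h0
    have := ENNReal.tsum_eq_zero.1 h0 ξ₀
    rw [if_pos (getElem?_joinRows _ _), hc, if_pos ⟨rfl, rfl⟩] at this
    exact hc0 this
  have hp1 : p ≠ ∞ := by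
    refine ne_top_of_le_ne_top ENNReal.one_ne_top ?_
    rw [← hmass]
    refine ENNReal.tsum_le_tsum fun ξ => ?_
    split_ifs
    · exact le_rfl
    · exact zero_le
  have hdiv : ∀ ξ, joinedDraw I S ξ =
      (if ξ[T]? = some none then eulerAlgorithm ξ₀ ξ else 0) / p := by
    intro ξ
    rw [ENNReal.eq_div_iff hp0 hp1, mul_comm, hdraw]
  constructor
  · refine ⟨c / p, fun ξ => ?_⟩
    rw [hdiv, hc]
    by_cases h1 : ξ[T]? = some none <;>
      by_cases h2 : ξ.head? = ξ₀.head? ∧ pairCount ξ = pairCount ξ₀ <;> simp [h1, h2]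
  · simp only [hdiv, div_eq_mul_inv]
    rw [ENNReal.tsum_mul_right, ← hp, ENNReal.mul_inv_cancel hp0 hp1]

theorem joinRows_of_joinedDraw_ne_zero {I : Fin n × Fin n} {S : Config n T 𝒮}
    {ξ : List (Option 𝒮)} (hξ : joinedDraw I S ξ ≠ 0) :
    ξ ∈ Set.range fun p : (Fin T → 𝒮) × (Fin T → 𝒮) => joinRows p.1 p.2 := by
  classical
  obtain ⟨⟨c, hc⟩, -⟩ := exists_joinedDraw_eq I S
  rw [hc] at hξ
  split_ifs at hξ with h
  · obtain ⟨x, y, hxy⟩ := exists_joinRows_eq h.1.1 h.1.2 h.2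
    exact ⟨(x, y), hxy⟩
  · exact absurd rfl hξ

theorem tsum_joinedDraw_mul (I : Fin n × Fin n) (S : Config n T 𝒮)
    (F : List (Option 𝒮) → ℝ≥0∞) : ∑' ξ, joinedDraw I S ξ * F ξ =
      ∑ p : (Fin T → 𝒮) × (Fin T → 𝒮), joinedDraw I S (joinRows p.1 p.2) * F (joinRows p.1 p.2) := by
  rw [← tsum_fintype (L := .unconditional _)]
  refine (joinRows_injective.tsum_eq (f := fun ξ => joinedDraw I S ξ * F ξ) fun ξ hξ => ?_).symm
  exact joinRows_of_joinedDraw_ne_zero (left_ne_zero_of_mul hξ)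

omit [Fintype 𝒮] [DecidableEq 𝒮] in
theorem pure_toSeq_apply [DecidableEq (Fin T → 𝒮)] (x y : Fin T → 𝒮) :
    (Law.pure (toSeq x) : Law (List (Option 𝒮))) (toSeq y) = if y = x then 1 else 0 := by
  classical
  rw [Law.pure_apply]
  simp only [toSeq_injective.eq_iff]

/-- The law of row `i` of the new states when the accepted joined rows are `p`. -/
noncomputable def rowLaw (I : Fin n × Fin n) (S : Config n T 𝒮) (p : (Fin T → 𝒮) × (Fin T → 𝒮))
    (i : Fin n) (y : Fin T → 𝒮) : ℝ≥0∞ :=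
  if i = I.1 then if y = p.1 then 1 else 0
  else if i = I.2 then if y = p.2 then 1 else 0
  else eulerAlgorithm (toSeq (S i)) (toSeq y)

theorem sum_rowLaw (hT : 1 ≤ T) (I : Fin n × Fin n) (S : Config n T 𝒮)
    (p : (Fin T → 𝒮) × (Fin T → 𝒮)) (i : Fin n) : ∑ y, rowLaw I S p i y = 1 := by
  unfold rowLaw
  split_ifs
  · simp
  · simp
  · exact sum_eulerAlgorithm_toSeq hT _

theorem modifiedEuler_of_ne {I : Fin n × Fin n} (hI : I.1 ≠ I.2)
    (S S' : Config n T 𝒮) : modifiedEuler I S S' =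
      ∑ p : (Fin T → 𝒮) × (Fin T → 𝒮), joinedDraw I S (joinRows p.1 p.2) *
        ∏ i, rowLaw I S p i (S' i) := by
  rw [modifiedEuler, modifiedEulerSeqs, if_pos hI, Law.bind, tsum_joinedDraw_mul]
  refine Finset.sum_congr rfl fun p _ => ?_
  congr 1
  refine Finset.prod_congr rfl fun i _ => ?_
  unfold rowLaw
  rw [take_joinRows, take_drop_joinRows]
  split_ifs <;> first | rfl | simp_all [pure_toSeq_apply]

/-- Almost sure halting: no mass is lost to endless runs, undefined instructions or outcomes that
are not configurations. -/
theorem sum_modifiedEuler (hT : 1 ≤ T) (I : Fin n × Fin n) (S : Config n T 𝒮) :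
    ∑ S', modifiedEuler I S S' = 1 := by
  by_cases hI : I.1 = I.2
  · simp only [modifiedEuler, modifiedEulerSeqs, hI, ne_eq, not_true_eq_false, if_false, Law.pi]
    exact sum_prod_eq_one fun i => sum_eulerAlgorithm_toSeq hT (S i)
  · simp only [modifiedEuler_of_ne hI]
    rw [Finset.sum_comm]
    simp only [← Finset.mul_sum, sum_prod_eq_one (sum_rowLaw hT I S _), mul_one]
    have h := tsum_joinedDraw_mul I S 1
    simp only [Pi.one_apply, mul_one] at h
    classical
    rw [← h, (exists_joinedDraw_eq I S).2]

open Classical in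
theorem exists_modifiedEuler_eq (hT : 1 ≤ T) (I : Fin n × Fin n) (S : Config n T 𝒮) :
    ∃ c : ℝ≥0∞, ∀ S', modifiedEuler I S S' = if S' ∈ RS I S then c else 0 := by
  have hrow := fun i => exists_eulerAlgorithm_eq (toSeq_ne_nil hT (S i))
  choose c hc using hrow
  by_cases hI : I.1 = I.2
  · refine ⟨∏ i, c i, fun S' => ?_⟩
    simp only [mem_RS_iff_of_eq hT hI, modifiedEuler, modifiedEulerSeqs, hI, ne_eq,
      not_true_eq_false, if_false, Law.pi, hc]
    rw [Finset.prod_ite_zero]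
    simp only [Finset.mem_univ, true_imp_iff]
  · obtain ⟨⟨d, hd⟩, -⟩ := exists_joinedDraw_eq I S
    refine ⟨d * ∏ i, if i ≠ I.1 ∧ i ≠ I.2 then c i else 1, fun S' => ?_⟩
    -- The accepted pair of rows can be read off from `S'`, so only one term survives.
    rw [modifiedEuler_of_ne hI, Finset.sum_eq_single (S' I.1, S' I.2)]
    · have h1 : ∀ i, rowLaw I S (S' I.1, S' I.2) i (S' i) =
          if (i ≠ I.1 → i ≠ I.2 → (toSeq (S' i)).head? = (toSeq (S i)).head? ∧
            pairCount (toSeq (S' i)) = pairCount (toSeq (S i))) then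
              (if i ≠ I.1 ∧ i ≠ I.2 then c i else 1) else 0 := by
        intro i
        unfold rowLaw
        by_cases hi1 : i = I.1
        · simp [hi1]
        by_cases hi2 : i = I.2
        · simp [hi2, Ne.symm hI]
        simp only [hi1, hi2, if_false, hc, ne_eq, not_false_eq_true, true_imp_iff, and_self, if_true]
      simp only [h1, hd, getElem?_joinRows, and_true]
      rw [Finset.prod_ite_zero]
      simp only [Finset.mem_univ, true_imp_iff, mem_RS_iff_of_ne hT hI, ite_and, ite_mul, mul_ite,
        zero_mul, mul_zero]
      split_ifs <;> rfl
    · intro p _ hp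
      have hp' : S' I.1 ≠ p.1 ∨ S' I.2 ≠ p.2 := by
        by_contra! h
        exact hp (Prod.ext h.1.symm h.2.symm)
      rcases hp' with h | h
      · rw [Finset.prod_eq_zero (Finset.mem_univ I.1), mul_zero]
        simp [rowLaw, h]
      · rw [Finset.prod_eq_zero (Finset.mem_univ I.2), mul_zero]
        simp [rowLaw, h, Ne.symm hI]
    · simp

/-- The outcome of the modified Euler algorithm is uniformly distributed on `RS I S`. -/
theorem modifiedEuler_eq (hT : 1 ≤ T) (I : Fin n × Fin n) (S S' : Config n T 𝒮) :
    modifiedEuler I S S' = if S' ∈ RS I S then ((RS I S).card : ℝ≥0∞)⁻¹ else 0 := by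
  classical
  obtain ⟨c, hc⟩ := exists_modifiedEuler_eq hT I S
  have hcard : c = ((RS I S).card : ℝ≥0∞)⁻¹ := eq_inv_card_of_sum_eq_one hc (sum_modifiedEuler hT I S)
  rw [hc, hcard]

end Outcome

/-- Almost sure halting is contained in the first part, as the stated probabilities sum to one over
the non-empty finite set `RS I S`. The second part substitutes this formula into the conditional law
given by `GeneratedByModifiedEuler`. -/
theorem mainTheorem8 {𝒮 : Type*} {𝒜 : Type*} [Fintype 𝒮] [DecidableEq 𝒮]
    {n T : ℕ} (hT : 1 ≤ T) :
    -- for a given pair of markets and given current states, the new states are uniform on `R_S`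
    (∀ (I : Fin n × Fin n) (S : Config n T 𝒮),
      (RS I S).Nonempty ∧
      ∀ S' : Config n T 𝒮,
        modifiedEuler I S S' = if S' ∈ RS I S then ((RS I S).card : ℝ≥0∞)⁻¹ else 0) ∧
    -- in the chain `X^(k) = (S^(k), A^(k))` with pairs `J k = I^(k)`, the conditional law of
    -- `S^(k)` given `(X^(1), …, X^(k-1), I^(k))` is uniform on `R_S(I^(k), S^(k-1))`
    (∀ {Ω : Type*} [MeasurableSpace Ω] (P : MeasureTheory.Measure Ω)
      [MeasureTheory.IsProbabilityMeasure P]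
      (X : ℕ → Ω → Config n T 𝒮 × Config n T 𝒜) (J : ℕ → Ω → Fin n × Fin n)
      (k : ℕ), 2 ≤ k → GeneratedByModifiedEuler P X J k →
      ∀ (x : ℕ → Config n T 𝒮 × Config n T 𝒜) (I : Fin n × Fin n),
        P (historyEvent X J k x I) ≠ 0 →
        ∀ S' : Config n T 𝒮,
          ProbabilityTheory.cond P (historyEvent X J k x I) {ω | (X k ω).1 = S'} =
            if S' ∈ RS I (x (k - 1)).1 then ((RS I (x (k - 1)).1).card : ℝ≥0∞)⁻¹ else 0) := by
  exact ⟨fun I S => ⟨⟨S, self_mem_RS I S⟩, modifiedEuler_eq hT I S⟩,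
    fun P _ X J k _ hX x I hP S' => by rw [hX x I hP S', modifiedEuler_eq hT]⟩
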